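/- **Notation.** For a complex-valued function $x$ in $L_1(\mathbf R)$ or $L_2(\mathbf R)$ let $X=\mathcal F x$ be its Fourier transform, $X(i\omega)=\int_{\mathbf R}e^{-i\omega t}x(t)\,dt$ (in the $L_2$ sense if $x\in L_2(\mathbf R)$). For $q>1$, $c>0$ let $\mathcal X(q,c)$ be the normed space of all complex-valued $x\in L_2(\mathbf R)$ with $$\|x\|_{\mathcal X(q,c)}=\operatorname*{ess\,sup}_{\omega\in\mathbf R}|X(i\omega)|\exp\frac{c}{|\omega|^q}<+\infty ,$$ and let $\mathcal X=\bigcup_{q>1,\,c>0}\mathcal X(q,c)$. Let $\mathcal K$ be the class of functions $\kappa:\mathbf R\to\mathbf R$ in $L_1(\mathbf R)$ or $L_2(\mathbf R)$ such that $\kappa(t)=0$ for $t>0$ and, for some integer $m>0$, some $a_1,\dots,a_m\in(0,+\infty)$ and some polynomial $d$ with $\deg d<m$, $(\mathcal F\kappa)(i\omega)=d(i\omega)/\prod_{k=1}^m(i\omega-a_k)$ for $\omega\in\mathbf R$. Let $\widehat{\mathcal K}$ be the class of functions $\widehat\kappa:\mathbf R\to\mathbf R$ in $L_2(\mathbf R)$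 such that $\widehat\kappa(t)=0$ for $t<0$ and the Laplace transform $z\mapsto\int_0^\infty e^{-zt}\widehat\kappa(t)\,dt$ belongs to $H^2\cap H^\infty$, where $H^r$ is the Hardy space of holomorphic functions $Q$ on $\{\operatorname{Re}z>0\}$ with $\sup_{s>0}\|Q(s+i\,\cdot)\|_{L_r(\mathbf R)}<\infty$. Write $(\kappa\circ x)(t)=\int_{\mathbf R}\kappa(t-s)x(s)\,ds$. Let $\mathcal Y_2=L_2(\mathbf R)$, and let $\mathcal Y_\infty$ be the space of bounded continuous functions $\mathbf R\to\mathbf C$ with the supremum norm. **Theorem.** Let $p=2$ or $p=\infty$. (i) The class $\mathcal X$ is $\mathcal Y_p$-predictable in the weak sense: for every $\kappa\in\mathcal K$ there is a sequence $\widehat\kappa_1,\widehat\kappa_2,\ldots\in\widehat{\mathcal K}$ such that, for every $x\in\mathcal X$, the functions $\kappa\circ x$ and $\widehat\kappa_j\circ x$ belong to $\mathcal Y_p$ and $\|\kappa\circ x-\widehat\kappa_j\circ x\|_{\mathcal Y_p}\to0$ as $j\to\infty$. (ii) For all $q_0>1$ and $c_0>0$, the class $\mathcal X(q_0,c_0)$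 is $\mathcal Y_p$-predictable in the weak sense uniformly with respect to the norm $\|\cdot\|_{\mathcal X(q_0,c_0)}$: for every $\kappa\in\mathcal K$ and $\varepsilon>0$ there is $\widehat\kappa\in\widehat{\mathcal K}$ such that, for every $x\in\mathcal X(q_0,c_0)$, the functions $\kappa\circ x$ and $\widehat\kappa\circ x$ belong to $\mathcal Y_p$ and $$\|\kappa\circ x-\widehat\kappa\circ x\|_{\mathcal Y_p}\le\varepsilon\,\|x\|_{\mathcal X(q_0,c_0)} .$$ -/

import Mathlib

open MeasureTheory Filter Topology
open scoped ENNReal FourierTransform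

noncomputable section

namespace WeakPrediction

/-- The Fourier transform `X(iω) = ∫ e^{-iωt} x(t) dt` of `x ∈ L₂(ℝ)`, as a function of `ω` that is
determined up to a null set. Mathlib's `𝓕` on `L₂` uses the character `e^{-2πitξ}`, hence the
rescaling `ξ = ω / (2π)`. -/
def fourierL2 (x : Lp ℂ 2 (volume : Measure ℝ)) (ω : ℝ) : ℂ :=
  (𝓕 x : Lp ℂ 2 (volume : Measure ℝ)) (ω / (2 * Real.pi))

/-- `F` is the Fourier transform `ω ↦ (ℱ f)(iω)` of the function `f`, which is either in `L₁(ℝ)`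
(the transform is the integral) or in `L₂(ℝ)` (the transform is an element of `L₂`). -/
def IsFourierTransform (f F : ℝ → ℂ) : Prop :=
  (Integrable f ∧ ∀ ω : ℝ, F ω = ∫ t : ℝ, Complex.exp (-(Complex.I * ω * t)) * f t) ∨
  (∃ hf : MemLp f 2 (volume : Measure ℝ), ∀ᵐ ω : ℝ, F ω = fourierL2 (hf.toLp f) ω)

/-- The Laplace transform `∫₀^∞ e^{-zt} f(t) dt`. -/
def laplace (f : ℝ → ℝ) (z : ℂ) : ℂ :=
  ∫ t in Set.Ioi (0 : ℝ), Complex.exp (-(z * t)) * (f t : ℂ)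

/-- The Hardy space `H^p` of the right half-plane `Re z > 0`. -/
def MemHardy (p : ℝ≥0∞) (Q : ℂ → ℂ) : Prop :=
  DifferentiableOn ℂ Q {z : ℂ | 0 < z.re} ∧
  (⨆ (s : ℝ) (_ : 0 < s),
    eLpNorm (fun ω : ℝ => Q ((s : ℂ) + Complex.I * ω)) p volume) < ∞

/-- The class `𝒦` of anticausal kernels with a rational Fourier transform `d / δ`, where
`δ(z) = ∏ (z - a_k)` with `a_k > 0` and `deg d < m`. -/
def AnticausalKernels : Set (ℝ → ℝ) :=
  {κ | (∀ t : ℝ, 0 < t → κ t = 0) ∧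
    ∃ (m : ℕ) (a : Fin m → ℝ) (d : Polynomial ℂ), 0 < m ∧ (∀ k, 0 < a k) ∧ d.degree < m ∧
      IsFourierTransform (fun t => (κ t : ℂ))
        (fun ω => d.eval (Complex.I * ω) / ∏ k, (Complex.I * ω - (a k : ℂ)))}

/-- The class `𝒦̂` of causal kernels in `L₂(ℝ)` whose Laplace transform lies in `H² ∩ H^∞`. -/
def CausalKernels : Set (ℝ → ℝ) :=
  {κ | MemLp κ 2 (volume : Measure ℝ) ∧ (∀ t : ℝ, t < 0 → κ t = 0) ∧
    MemHardy 2 (laplace κ) ∧ MemHardy ∞ (laplace κ)}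

/-- The convolution `(κ ∘ x)(t) = ∫ κ(t - s) x(s) ds` of a real kernel and a complex function. -/
def conv (κ : ℝ → ℝ) (x : ℝ → ℂ) : ℝ → ℂ :=
  convolution κ x (ContinuousLinearMap.lsmul ℝ ℝ) volume

/-- The norm of `𝒴_p`: the `L_p` norm for `p < ∞`, the supremum norm of `C(ℝ)` for `p = ∞`. -/
def yNorm (p : ℝ≥0∞) (f : ℝ → ℂ) : ℝ≥0∞ :=
  if p = ∞ then ⨆ t : ℝ, ‖f t‖ₑ else eLpNorm f p volume

/-- Membership in `𝒴_p`: `L_p(ℝ)` for `p < ∞`, and the bounded continuous functions for `p = ∞`. -/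
def MemY (p : ℝ≥0∞) (f : ℝ → ℂ) : Prop :=
  if p = ∞ then Continuous f ∧ yNorm p f < ∞ else MemLp f p (volume : Measure ℝ)

/-- `𝒴_p`-predictability in the weak sense. The kernels do not depend on the input `x`. -/
def WeaklyPredictable (p : ℝ≥0∞) (S : Set (Lp ℂ 2 (volume : Measure ℝ))) : Prop :=
  ∀ κ ∈ AnticausalKernels, ∃ κ' : ℕ → ℝ → ℝ, (∀ j, κ' j ∈ CausalKernels) ∧
    ∀ x ∈ S, MemY p (conv κ x) ∧ (∀ j, MemY p (conv (κ' j) x)) ∧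
      Tendsto (fun j => yNorm p (conv κ x - conv (κ' j) x)) atTop (𝓝 0)

/-- `𝒴_p`-predictability in the weak sense, uniformly with respect to the norm `N`. -/
def UniformlyWeaklyPredictable (p : ℝ≥0∞) (S : Set (Lp ℂ 2 (volume : Measure ℝ)))
    (N : Lp ℂ 2 (volume : Measure ℝ) → ℝ≥0∞) : Prop :=
  ∀ κ ∈ AnticausalKernels, ∀ ε : ℝ, 0 < ε → ∃ κ' ∈ CausalKernels,
    ∀ x ∈ S, MemY p (conv κ x) ∧ MemY p (conv κ' x) ∧
      yNorm p (conv κ x - conv κ' x) ≤ ENNReal.ofReal ε * N x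

/-- The weight `h(ω, q, c) = exp (c / |ω|^q)`. Its value at the single point `ω = 0` is
irrelevant below. -/
def weight (ω q c : ℝ) : ℝ := Real.exp (c / |ω| ^ q)

/-- The norm `ess sup |X(iω)| h(ω, q, c)`. -/
def xNorm (q c : ℝ) (x : Lp ℂ 2 (volume : Measure ℝ)) : ℝ≥0∞ :=
  essSup (fun ω : ℝ => ‖fourierL2 x ω‖ₑ * ENNReal.ofReal (weight ω q c)) volume

/-- The class `𝒳(q, c)`. -/
def XClass (q c : ℝ) : Set (Lp ℂ 2 (volume : Measure ℝ)) := {x | xNorm q c x < ∞}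

/-- The class `𝒳`, the union of the `𝒳(q, c)` over `q > 1` and `c > 0`. -/
def XUnion : Set (Lp ℂ 2 (volume : Measure ℝ)) :=
  {x | ∃ q c : ℝ, 1 < q ∧ 0 < c ∧ x ∈ XClass q c}

end WeakPrediction

end

/-! Write K for the transform of κ, a proper rational function with poles a_k > 0. A causal
substitute is obtained by cancelling the poles: K is multiplied by ∏ (1 - G_k), where G_k equals 1
at z = a_k and is tiny on most of the imaginary axis. With w = 1/(z + ε), take G_k = (1 - ε(z -
a_k)/(z + ε))^n (a_k + ε)w. This is a polynomial in w, so K ∏ (1 - G_k) is w times a real polynomial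
in w (`exists_causalTransfer_eq`), the Laplace transform of a causal kernel built from t^j e^{-εt}.
The error is K (1 - ∏ (1 - G_k)). With nε = γ, the square of the n-th power in G_k is at most
exp(-γ(ω² - εA)/(ω² + ε²)) in modulus, where A depends only on a bound for the poles. For fixed ω ≠
0 and ε → 0 suitably in terms of γ, this tends to 0 as γ → ∞. It may be large only where ω² < εA;
there it is at most exp(γA/|ω|), and since q > 1 this is dominated by exp(c/|ω|^q) once ε is small
enough in terms of γ (`exists_norm_factor_pow_le`). Thus the weight of 𝒳(q, c) absorbs the blow-up
at ω = 0, and dominated convergence makes the weighted error small in L₁ and L₂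
(`exists_causalTransfer_approx`). Plancherel and the L₁ bound on the inverse transform turn this
into the two 𝒴_p estimates (`yNorm_conv_sub_le`), uniformly over 𝒳(q, c). For the union, (q, c) is
let tend to (1, 0) along the sequence of kernels. -/

namespace WeakPrediction

/-! ### Fourier transforms on L₁ and L₂, and the convolution theorem on L₂ × L₂. -/

open scoped SchwartzMap ComplexConjugate ContDiff

/-- Two locally integrable functions that agree as tempered distributions are equal a.e. -/
theorem ae_eq_of_integral_schwartz_mul_eq {f g : ℝ → ℂ} (hf : LocallyIntegrable f)
    (hg : LocallyIntegrable g) (h : ∀ φ : 𝓢(ℝ, ℂ), ∫ t, φ t * f t = ∫ t, φ t * g t) :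
    f =ᵐ[volume] g := by
  refine ae_eq_of_integral_contDiff_smul_eq hf hg fun φ hφ hφc => ?_
  have h₁ : HasCompactSupport (Complex.ofRealCLM ∘ φ) := hφc.comp_left rfl
  have h₂ : ContDiff ℝ ∞ (Complex.ofRealCLM ∘ φ) := by fun_prop
  simpa using h (h₁.toSchwartzMap h₂)

/-- The multiplication formula for the Fourier transform on `L₂`. -/
theorem integral_schwartz_mul_fourier_L2 (φ : 𝓢(ℝ, ℂ)) (f : Lp ℂ 2 (volume : Measure ℝ)) :
    ∫ t, φ t * (𝓕 f : Lp ℂ 2 (volume : Measure ℝ)) t = ∫ t, (𝓕 φ : 𝓢(ℝ, ℂ)) t * f t := by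
  have h := congrArg (fun T => T φ) (Lp.fourier_toTemperedDistribution_eq f)
  simp only [TemperedDistribution.fourier_apply, Lp.toTemperedDistribution_apply,
    smul_eq_mul] at h
  exact h.symm

/-- The multiplication formula for the Fourier transform on `L₁`. -/
theorem integral_schwartz_mul_fourier_L1 (φ : 𝓢(ℝ, ℂ)) {f : ℝ → ℂ} (hf : Integrable f) :
    ∫ t, φ t * 𝓕 f t = ∫ t, (𝓕 φ : 𝓢(ℝ, ℂ)) t * f t := by
  have h := VectorFourier.integral_fourierIntegral_smul_eq_flip (L := innerₗ ℝ)
    Real.continuous_fourierChar continuous_inner (φ.integrable (μ := volume)) hf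
  simp only [flip_innerₗ] at h
  exact h.symm

theorem continuous_fourier {f : ℝ → ℂ} (hf : Integrable f) : Continuous (𝓕 f) :=
  VectorFourier.fourierIntegral_continuous (L := innerₗ ℝ) Real.continuous_fourierChar
    continuous_inner hf

/-- The integral and the `L₂` Fourier transform agree on `L₁ ∩ L₂`. -/
theorem fourier_toLp_ae_eq {f : ℝ → ℂ} (hf : Integrable f) (hf₂ : MemLp f 2) :
    (𝓕 (hf₂.toLp f) : Lp ℂ 2 (volume : Measure ℝ)) =ᵐ[volume] 𝓕 f := by
  refine ae_eq_of_integral_schwartz_mul_eq ((Lp.memLp _).locallyIntegrable (by norm_num))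
    (continuous_fourier hf).locallyIntegrable fun φ => ?_
  rw [integral_schwartz_mul_fourier_L2, integral_schwartz_mul_fourier_L1 φ hf]
  refine integral_congr_ae ?_
  filter_upwards [hf₂.coeFn_toLp] with t ht
  rw [ht]

/-- An integrable function whose Fourier transform is in `L₂` is in `L₂`, and the two transforms
agree. -/
theorem exists_memLp_of_fourier_memLp {f F : ℝ → ℂ} (hf : Integrable f) (hF : MemLp F 2)
    (h : 𝓕 f = F) : ∃ hf₂ : MemLp f 2,
      (𝓕 (hf₂.toLp f) : Lp ℂ 2 (volume : Measure ℝ)) =ᵐ[volume] F := by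
  have key : f =ᵐ[volume] (𝓕⁻ (hF.toLp F) : Lp ℂ 2 (volume : Measure ℝ)) := by
    refine ae_eq_of_integral_schwartz_mul_eq hf.locallyIntegrable
      ((Lp.memLp _).locallyIntegrable (by norm_num)) fun φ => ?_
    -- Written as a transform, the test function can pass its `𝓕` to f, where it becomes F.
    have hφ : φ = 𝓕 (𝓕⁻ φ) := (FourierTransform.fourier_fourierInv_eq φ).symm
    rw [hφ, ← integral_schwartz_mul_fourier_L1 _ hf, ← integral_schwartz_mul_fourier_L2,
      FourierTransform.fourier_fourierInv_eq, h]
    refine integral_congr_ae ?_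
    filter_upwards [hF.coeFn_toLp] with t ht
    rw [ht]
  have hf₂ : MemLp f 2 := (memLp_congr_ae key).2 (Lp.memLp _)
  exact ⟨hf₂, h ▸ fourier_toLp_ae_eq hf hf₂⟩

/-- The `L₂` Fourier transform of a real function is conjugate symmetric. -/
theorem fourier_neg_ae_eq_conj {κ : ℝ → ℝ} (hκ : MemLp (fun t => (κ t : ℂ)) 2) :
    (fun ξ => (𝓕 (hκ.toLp _) : Lp ℂ 2 (volume : Measure ℝ)) (-ξ)) =ᵐ[volume]
      fun ξ => conj ((𝓕 (hκ.toLp _) : Lp ℂ 2 (volume : Measure ℝ)) ξ) := by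
  set F : Lp ℂ 2 (volume : Measure ℝ) := 𝓕 (hκ.toLp _) with hF
  have h₁ : MemLp (fun ξ => F (-ξ)) 2 :=
    (Lp.memLp F).comp_measurePreserving (Measure.measurePreserving_neg volume)
  have h₂ : MemLp (fun ξ => conj (F ξ)) 2 := (Lp.memLp F).star
  refine ae_eq_of_integral_contDiff_smul_eq (h₁.locallyIntegrable (by norm_num))
    (h₂.locallyIntegrable (by norm_num)) fun φ hφ hφc => ?_
  have h₃ : HasCompactSupport (Complex.ofRealCLM ∘ φ) := hφc.comp_left rfl
  have h₄ : ContDiff ℝ ∞ (Complex.ofRealCLM ∘ φ) := by fun_prop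
  set ψ : 𝓢(ℝ, ℂ) := h₃.toSchwartzMap h₄ with hψ
  have hψt : ∀ t, ψ t = (φ t : ℂ) := fun t => rfl
  set ψ' : 𝓢(ℝ, ℂ) :=
    SchwartzMap.compCLMOfContinuousLinearEquiv ℂ (ContinuousLinearEquiv.neg ℝ) ψ with hψ'
  have hψ't : ∀ t, ψ' t = (φ (-t) : ℂ) := fun t => rfl
  -- For a real test function, reflection conjugates the transform; duality carries this over to F.
  have hconj : ∀ t, (𝓕 ψ' : 𝓢(ℝ, ℂ)) t = conj ((𝓕 ψ : 𝓢(ℝ, ℂ)) t) := by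
    intro t
    rw [SchwartzMap.fourier_coe, SchwartzMap.fourier_coe, Real.fourier_real_eq_integral_exp_smul,
      Real.fourier_real_eq_integral_exp_smul, ← integral_conj, ← integral_neg_eq_self]
    refine integral_congr_ae (.of_forall fun v => ?_)
    simp only [hψ't, hψt, smul_eq_mul, map_mul, ← Complex.exp_conj, Complex.conj_I,
      Complex.conj_ofReal, neg_neg]
    congr 2
    push_cast
    ring
  have hreal : ∀ {g : 𝓢(ℝ, ℂ)}, ∫ t, g t * (hκ.toLp _ : Lp ℂ 2 (volume : Measure ℝ)) t =
      ∫ t, g t * (κ t : ℂ) := by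
    intro g
    refine integral_congr_ae ?_
    filter_upwards [hκ.coeFn_toLp] with t ht
    rw [ht]
  calc ∫ ξ, φ ξ • F (-ξ) = ∫ ξ, φ (-ξ) • F ξ := by
        rw [← integral_neg_eq_self]; simp
    _ = ∫ ξ, ψ' ξ * F ξ := by simp [hψ't]
    _ = ∫ t, (𝓕 ψ' : 𝓢(ℝ, ℂ)) t * (κ t : ℂ) := by
        rw [hF, integral_schwartz_mul_fourier_L2, hreal]
    _ = conj (∫ t, (𝓕 ψ : 𝓢(ℝ, ℂ)) t * (κ t : ℂ)) := by
        rw [← integral_conj]; simp [hconj]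
    _ = conj (∫ ξ, ψ ξ * F ξ) := by
        rw [hF, integral_schwartz_mul_fourier_L2, hreal]
    _ = ∫ ξ, φ ξ • conj (F ξ) := by
        rw [← integral_conj]; simp [hψt]

/-- The convolution theorem on `L₂ × L₂`: the convolution is the inverse Fourier transform of the
integrable product of the transforms. -/
theorem conv_eq_fourierInv {κ : ℝ → ℝ} (hκ : MemLp (fun t => (κ t : ℂ)) 2)
    (x : Lp ℂ 2 (volume : Measure ℝ)) :
    conv κ x = 𝓕⁻ (fun ξ => (𝓕 (hκ.toLp _) : Lp ℂ 2 (volume : Measure ℝ)) ξ *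
      (𝓕 x : Lp ℂ 2 (volume : Measure ℝ)) ξ) := by
  funext t
  set F : Lp ℂ 2 (volume : Measure ℝ) := 𝓕 (hκ.toLp _) with hF
  have hu : MemLp (fun s => conj (κ (t - s) : ℂ)) 2 :=
    (hκ.comp_measurePreserving (Measure.measurePreserving_sub_left volume t)).star
  have hv : MemLp (fun ξ => conj ((Real.fourierChar (ξ * t) : ℂ) * F ξ)) 2 := by
    refine MemLp.star ((Lp.memLp F).of_le ?_ ?_)
    · refine AEStronglyMeasurable.mul ?_ (Lp.memLp F).1
      exact (continuous_induced_dom.comp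
        (Real.continuous_fourierChar.comp (by fun_prop))).aestronglyMeasurable
    · exact .of_forall fun ξ => by simp [Circle.norm_coe]
  have e₁ : ∀ y : Lp ℂ 2 (volume : Measure ℝ), conv κ y t = inner ℂ (hu.toLp _) y := by
    intro y
    rw [L2.inner_def, conv, convolution_eq_swap]
    refine integral_congr_ae ?_
    filter_upwards [hu.coeFn_toLp] with s hs
    rw [hs]
    simp [mul_comm]
  have e₂ : ∀ y : Lp ℂ 2 (volume : Measure ℝ), 𝓕⁻ (fun ξ => F ξ * y ξ) t =
      inner ℂ (hv.toLp _) y := by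
    intro y
    rw [L2.inner_def, Real.fourierInv_eq]
    refine integral_congr_ae ?_
    filter_upwards [hv.coeFn_toLp] with ξ hξ
    rw [hξ]
    simp [Circle.smul_def, mul_comm, mul_left_comm]
  rw [e₁, e₂]
  -- At a fixed t both sides are inner products of x or `𝓕 x` with fixed L₂ vectors, hence
  -- continuous in x, and Schwartz functions suffice.
  refine DenseRange.induction_on
    (p := fun y : Lp ℂ 2 (volume : Measure ℝ) => inner ℂ (hu.toLp _) y =
      inner ℂ (hv.toLp _) (𝓕 y : Lp ℂ 2 (volume : Measure ℝ)))
    (SchwartzMap.denseRange_toLpCLM (p := 2) ENNReal.ofNat_ne_top) x ?_ ?_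
  · refine isClosed_eq (continuous_const.inner continuous_id) (continuous_const.inner ?_)
    exact (Lp.fourierTransformₗᵢ ℝ ℂ).continuous
  intro g
  rw [← e₁, SchwartzMap.toLpCLM_apply, SchwartzMap.toLp_fourier_eq, ← e₂]
  set g' : 𝓢(ℝ, ℂ) := SchwartzMap.compCLMOfContinuousLinearEquiv ℂ (ContinuousLinearEquiv.neg ℝ)
    (SchwartzMap.compSubConstCLM ℂ (-t) g) with hg'
  have hg't : ∀ s, g' s = g (t - s) := fun s => by
    simp [hg', sub_eq_add_neg, add_comm]
  -- The convolution at t pairs κ with s ↦ g(t - s) = 𝓕ψ, so the multiplication formula applies.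
  set ψ : 𝓢(ℝ, ℂ) := 𝓕⁻ g' with hψ
  have hψt : ∀ ξ, ψ ξ = (Real.fourierChar (ξ * t) : ℂ) * (𝓕 g : 𝓢(ℝ, ℂ)) ξ := by
    intro ξ
    rw [hψ, SchwartzMap.fourierInv_coe, SchwartzMap.fourier_coe, Real.fourierInv_eq,
      Real.fourier_real_eq, ← integral_const_mul, ← integral_sub_left_eq_self _ volume t]
    refine integral_congr_ae (.of_forall fun s => ?_)
    simp only [hg't, Circle.smul_def, smul_eq_mul, ← mul_assoc, ← Circle.coe_mul,
      ← AddChar.map_add_eq_mul, sub_sub_cancel]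
    congr 3
    simp
    ring
  have hL : conv κ (g.toLp 2 : Lp ℂ 2 (volume : Measure ℝ)) t =
      ∫ s, (𝓕 ψ : 𝓢(ℝ, ℂ)) s * (hκ.toLp _ : Lp ℂ 2 (volume : Measure ℝ)) s := by
    rw [conv, convolution_def, hψ, FourierTransform.fourier_fourierInv_eq]
    refine integral_congr_ae ?_
    filter_upwards [hκ.coeFn_toLp,
      (Measure.measurePreserving_sub_left volume t).quasiMeasurePreserving.ae (g.coeFn_toLp 2 volume)] with s hs hs'
    rw [hs, hg't, hs']
    simp [mul_comm]
  rw [hL, ← integral_schwartz_mul_fourier_L2, Real.fourierInv_eq]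
  refine integral_congr_ae ?_
  filter_upwards [(𝓕 g).coeFn_toLp 2 volume] with ξ hξ
  rw [hξ, hψt]
  simp [Circle.smul_def, hF, mul_comm, mul_assoc]

end WeakPrediction

/-! ### From transfer functions to norms of convolutions. -/

namespace WeakPrediction

open scoped ComplexConjugate

theorem enorm_fourierInv_le (H : ℝ → ℂ) (t : ℝ) : ‖𝓕⁻ H t‖ₑ ≤ ∫⁻ ξ, ‖H ξ‖ₑ := by
  rw [Real.fourierInv_eq]
  refine (enorm_integral_le_lintegral_enorm _).trans (le_of_eq (lintegral_congr fun s => ?_))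
  rw [← ofReal_norm, Circle.norm_smul, ofReal_norm]

theorem memY_fourierInv {p : ℝ≥0∞} (hp : p = 2 ∨ p = ∞) {H : ℝ → ℂ} (h₁ : Integrable H)
    (h₂ : MemLp H 2) : MemY p (𝓕⁻ H) := by
  have hneg : 𝓕⁻ H = (𝓕 H) ∘ Neg.neg := funext fun t => Real.fourierInv_eq_fourier_neg H t
  rcases hp with rfl | rfl
  · simp only [MemY, ENNReal.ofNat_ne_top, if_false]
    rw [hneg]
    exact ((memLp_congr_ae (fourier_toLp_ae_eq h₁ h₂)).1 (Lp.memLp _)).comp_measurePreserving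
      (Measure.measurePreserving_neg volume)
  · simp only [MemY, yNorm, if_true]
    refine ⟨hneg ▸ (continuous_fourier h₁).comp continuous_neg, ?_⟩
    exact lt_of_le_of_lt (iSup_le fun t => enorm_fourierInv_le H t) h₁.2

/-- Plancherel for p = 2, the triangle inequality for p = ∞. Taking the maximum lets both cases
share one estimate. -/
theorem yNorm_fourierInv_le {p : ℝ≥0∞} (hp : p = 2 ∨ p = ∞) {H : ℝ → ℂ} (h₁ : Integrable H)
    (h₂ : MemLp H 2) : yNorm p (𝓕⁻ H) ≤ max (eLpNorm H 1 volume) (eLpNorm H 2 volume) := by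
  have hneg : 𝓕⁻ H = (𝓕 H) ∘ Neg.neg := funext fun t => Real.fourierInv_eq_fourier_neg H t
  rcases hp with rfl | rfl
  · refine le_max_of_le_right (le_of_eq ?_)
    have hF := fourier_toLp_ae_eq h₁ h₂
    simp only [yNorm, ENNReal.ofNat_ne_top, if_false]
    rw [hneg, eLpNorm_comp_measurePreserving (continuous_fourier h₁).aestronglyMeasurable
      (Measure.measurePreserving_neg volume), ← eLpNorm_congr_ae hF, ← Lp.enorm_def,
      ← ofReal_norm, Lp.norm_fourier_eq, ofReal_norm, Lp.enorm_def,
      eLpNorm_congr_ae h₂.coeFn_toLp]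
  · refine le_max_of_le_left ?_
    simp only [yNorm, if_true, eLpNorm_one_eq_lintegral_enorm]
    exact iSup_le fun t => enorm_fourierInv_le H t

theorem ae_comp_two_pi_mul {P : ℝ → Prop} (h : ∀ᵐ ω : ℝ, P ω) :
    ∀ᵐ ξ : ℝ, P (2 * Real.pi * ξ) :=
  (Measure.quasiMeasurePreserving_smul volume (by positivity : 2 * Real.pi ≠ 0)).ae h

theorem abs_le_abs_two_pi_mul (ξ : ℝ) : |ξ| ≤ |2 * Real.pi * ξ| := by
  rw [abs_mul, abs_of_pos (by positivity : 0 < 2 * Real.pi)]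
  nlinarith [abs_nonneg ξ, Real.pi_gt_three]

/-- `K` is continuous and `O(1 / (1 + |ω|))`: the transfer functions that occur here. -/
def IsTransfer (K : ℝ → ℂ) : Prop :=
  Continuous K ∧ ∃ C : ℝ, ∀ ω, ‖K ω‖ ≤ C * (1 + |ω|)⁻¹

theorem integrable_inv_one_add_abs_sq : Integrable fun ω : ℝ => ((1 + |ω|)⁻¹) ^ 2 := by
  refine integrable_inv_one_add_sq.mono' (by fun_prop) (.of_forall fun ω => ?_)
  rw [Real.norm_of_nonneg (by positivity), inv_pow]
  gcongr
  nlinarith [abs_nonneg ω, sq_abs ω]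

theorem IsTransfer.memLp {K : ℝ → ℂ} (hK : IsTransfer K) :
    MemLp (fun ξ => K (2 * Real.pi * ξ)) 2 := by
  obtain ⟨hc, C, hC⟩ := hK
  have hm : AEStronglyMeasurable (fun ξ => K (2 * Real.pi * ξ)) volume :=
    (hc.comp (by fun_prop)).aestronglyMeasurable
  rw [memLp_two_iff_integrable_sq_norm hm]
  refine (integrable_inv_one_add_abs_sq.const_mul (C ^ 2)).mono' (hm.norm.pow 2)
    (.of_forall fun ξ => ?_)
  have h1 := abs_le_abs_two_pi_mul ξ
  have hC0 : 0 ≤ C := by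
    have := (norm_nonneg _).trans (hC 0)
    simpa using this
  rw [Real.norm_of_nonneg (by positivity), ← mul_pow]
  have h2 : (1 + |2 * Real.pi * ξ|)⁻¹ ≤ (1 + |ξ|)⁻¹ := by gcongr
  have := (hC (2 * Real.pi * ξ)).trans (mul_le_mul_of_nonneg_left h2 hC0)
  gcongr

theorem IsTransfer.bounded {K : ℝ → ℂ} (hK : IsTransfer K) : ∃ C : ℝ, ∀ ω, ‖K ω‖ ≤ C := by
  obtain ⟨hc, C, hC⟩ := hK
  have hC0 : 0 ≤ C := by
    have := (norm_nonneg _).trans (hC 0)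
    simpa using this
  exact ⟨C, fun ω => (hC ω).trans (mul_le_of_le_one_right hC0
    (inv_le_one_of_one_le₀ (by simp)))⟩

theorem IsTransfer.sub {K L : ℝ → ℂ} (hK : IsTransfer K) (hL : IsTransfer L) :
    IsTransfer (K - L) := by
  obtain ⟨hc, C, hC⟩ := hK
  obtain ⟨hd, D, hD⟩ := hL
  refine ⟨hc.sub hd, C + D, fun ω => ?_⟩
  rw [add_mul]
  exact (norm_sub_le _ _).trans (add_le_add (hC ω) (hD ω))

/-- The kernel `κ` is in `L₂` and `K` is its Fourier transform. -/
def HasTransfer (κ : ℝ → ℝ) (K : ℝ → ℂ) : Prop :=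
  IsTransfer K ∧ ∃ hκ : MemLp (fun t => (κ t : ℂ)) 2,
    (𝓕 (hκ.toLp _) : Lp ℂ 2 (volume : Measure ℝ)) =ᵐ[volume] fun ξ => K (2 * Real.pi * ξ)

theorem IsTransfer.integrable_mul {K : ℝ → ℂ} (hK : IsTransfer K)
    (y : Lp ℂ 2 (volume : Measure ℝ)) : Integrable fun ξ => K (2 * Real.pi * ξ) * y ξ :=
  hK.memLp.integrable_mul (Lp.memLp y)

theorem IsTransfer.memLp_mul {K : ℝ → ℂ} (hK : IsTransfer K)
    (y : Lp ℂ 2 (volume : Measure ℝ)) : MemLp (fun ξ => K (2 * Real.pi * ξ) * y ξ) 2 := by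
  obtain ⟨C, hC⟩ := hK.bounded
  refine (Lp.memLp y).of_le_mul (c := C) (hK.integrable_mul y).1 (.of_forall fun ξ => ?_)
  rw [norm_mul]
  gcongr
  exact hC _

theorem HasTransfer.conv_eq {κ : ℝ → ℝ} {K : ℝ → ℂ} (h : HasTransfer κ K)
    (x : Lp ℂ 2 (volume : Measure ℝ)) :
    conv κ x = 𝓕⁻ (fun ξ => K (2 * Real.pi * ξ) * (𝓕 x : Lp ℂ 2 (volume : Measure ℝ)) ξ) := by
  obtain ⟨-, hκ, hF⟩ := h
  rw [conv_eq_fourierInv hκ]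
  funext t
  refine Real.fourierInv_congr_ae ?_ t
  filter_upwards [hF] with ξ hξ
  rw [hξ]

theorem HasTransfer.memY_conv {p : ℝ≥0∞} (hp : p = 2 ∨ p = ∞) {κ : ℝ → ℝ} {K : ℝ → ℂ}
    (h : HasTransfer κ K) (x : Lp ℂ 2 (volume : Measure ℝ)) : MemY p (conv κ x) := by
  rw [h.conv_eq]
  exact memY_fourierInv hp (h.1.integrable_mul _) (h.1.memLp_mul _)

theorem weight_pos (ω q c : ℝ) : 0 < weight ω q c := Real.exp_pos _

theorem enorm_fourier_mul_weight_le (q c : ℝ) (x : Lp ℂ 2 (volume : Measure ℝ)) :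
    ∀ᵐ ξ : ℝ, ‖(𝓕 x : Lp ℂ 2 (volume : Measure ℝ)) ξ‖ₑ *
      ENNReal.ofReal (weight (2 * Real.pi * ξ) q c) ≤ xNorm q c x := by
  filter_upwards [ae_comp_two_pi_mul (ENNReal.ae_le_essSup fun ω : ℝ =>
    ‖fourierL2 x ω‖ₑ * ENNReal.ofReal (weight ω q c))] with ξ hξ
  rwa [fourierL2, mul_div_cancel_left₀ _ (by positivity)] at hξ

/-- Removes x from the problem: almost everywhere |X| is at most its weighted norm divided by the
weight, so only a weighted distance between transfer functions remains to be estimated. -/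
theorem yNorm_conv_sub_le {p : ℝ≥0∞} (hp : p = 2 ∨ p = ∞) {κ κ' : ℝ → ℝ} {K K' : ℝ → ℂ}
    (h : HasTransfer κ K) (h' : HasTransfer κ' K') {q c : ℝ} {δ : ℝ≥0∞}
    (hδ : ∀ r : ℝ≥0∞, r = 1 ∨ r = 2 → eLpNorm (fun ξ : ℝ =>
      ‖K (2 * Real.pi * ξ) - K' (2 * Real.pi * ξ)‖ / weight (2 * Real.pi * ξ) q c) r volume ≤ δ)
    {x : Lp ℂ 2 (volume : Measure ℝ)} (hx : x ∈ XClass q c) :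
    yNorm p (conv κ x - conv κ' x) ≤ δ * xNorm q c x := by
  have hsub : conv κ x - conv κ' x = 𝓕⁻ (fun ξ => (K - K') (2 * Real.pi * ξ) *
      (𝓕 x : Lp ℂ 2 (volume : Measure ℝ)) ξ) := by
    rw [h.conv_eq, h'.conv_eq]
    funext t
    simp only [Pi.sub_apply, Real.fourierInv_eq, sub_mul, smul_sub]
    have hi : ∀ {L : ℝ → ℂ}, IsTransfer L → Integrable fun ξ : ℝ =>
        Real.fourierChar (inner ℝ ξ t) • (L (2 * Real.pi * ξ) *
          (𝓕 x : Lp ℂ 2 (volume : Measure ℝ)) ξ) := by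
      intro L hL
      have := (Real.fourierIntegral_convergent_iff (-t)).2
        (hL.integrable_mul (𝓕 x : Lp ℂ 2 (volume : Measure ℝ)))
      simpa using this
    rw [integral_sub (hi h.1) (hi h'.1)]
  have hd := h.1.sub h'.1
  rw [hsub]
  refine (yNorm_fourierInv_le hp (hd.integrable_mul _) (hd.memLp_mul _)).trans ?_
  have key : ∀ r : ℝ≥0∞, r = 1 ∨ r = 2 → eLpNorm (fun ξ => (K - K') (2 * Real.pi * ξ) *
      (𝓕 x : Lp ℂ 2 (volume : Measure ℝ)) ξ) r volume ≤ δ * xNorm q c x := by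
    intro r hr
    have hx' : xNorm q c x ≠ ∞ := ne_of_lt hx
    have := eLpNorm_le_nnreal_smul_eLpNorm_of_ae_le_mul (μ := volume) (c := (xNorm q c x).toNNReal)
      (f := fun ξ => (K - K') (2 * Real.pi * ξ) * (𝓕 x : Lp ℂ 2 (volume : Measure ℝ)) ξ)
      (g := fun ξ : ℝ => ‖K (2 * Real.pi * ξ) - K' (2 * Real.pi * ξ)‖ /
        weight (2 * Real.pi * ξ) q c) ?_ r
    · refine this.trans ?_
      rw [ENNReal.smul_def, smul_eq_mul, ENNReal.coe_toNNReal hx', mul_comm]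
      gcongr
      exact hδ r hr
    · filter_upwards [enorm_fourier_mul_weight_le q c x] with ξ hξ
      have hw := weight_pos (2 * Real.pi * ξ) q c
      rw [← NNReal.coe_le_coe]
      have h1 : ‖(𝓕 x : Lp ℂ 2 (volume : Measure ℝ)) ξ‖ * weight (2 * Real.pi * ξ) q c ≤
          (xNorm q c x).toReal := by
        have := ENNReal.toReal_mono hx' hξ
        simpa [ENNReal.toReal_mul, ENNReal.toReal_ofReal hw.le] using this
      simp only [coe_nnnorm, NNReal.coe_mul, norm_mul, norm_div, norm_norm, Pi.sub_apply]
      rw [Real.norm_of_nonneg hw.le, ← mul_div_assoc, le_div_iff₀ hw, mul_assoc, mul_comm]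
      gcongr
      exact h1
  exact max_le (key 1 (.inl rfl)) (key 2 (.inr rfl))

end WeakPrediction

/-! ### Rational transfer functions of anticausal kernels. -/

namespace WeakPrediction

open scoped ComplexConjugate

/-- The rational function `d(iω) / ∏ (iω - a_k)`. -/
noncomputable def ratTransfer {m : ℕ} (a : Fin m → ℝ) (d : Polynomial ℂ) (ω : ℝ) : ℂ :=
  d.eval (Complex.I * ω) / ∏ k, (Complex.I * ω - (a k : ℂ))

theorem natDegree_lt_of_degree_lt {R : Type*} [Semiring R] {m : ℕ} (hm : 0 < m) {d : Polynomial R}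
    (hd : d.degree < m) : d.natDegree < m := by
  rcases eq_or_ne d 0 with rfl | h
  · simpa
  · exact (Polynomial.natDegree_lt_iff_degree_lt h).2 hd

theorem norm_I_mul_sub_ge {a : ℝ} (ha : 0 < a) (ω : ℝ) :
    a / (1 + a) * (1 + |ω|) ≤ ‖Complex.I * ω - (a : ℂ)‖ := by
  have h1 : |ω| ≤ ‖Complex.I * ω - (a : ℂ)‖ := by
    simpa using Complex.abs_im_le_norm (Complex.I * ω - (a : ℂ))
  have h2 : a ≤ ‖Complex.I * ω - (a : ℂ)‖ := by
    simpa [abs_of_pos ha] using Complex.abs_re_le_norm (Complex.I * ω - (a : ℂ))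
  rw [div_mul_eq_mul_div, div_le_iff₀ (by positivity)]
  nlinarith

theorem I_mul_sub_ne_zero {a : ℝ} (ha : 0 < a) (ω : ℝ) : Complex.I * ω - (a : ℂ) ≠ 0 := by
  refine norm_pos_iff.1 (lt_of_lt_of_le ?_ (norm_I_mul_sub_ge ha ω))
  positivity

theorem isTransfer_ratTransfer {m : ℕ} {a : Fin m → ℝ} (ha : ∀ k, 0 < a k) {d : Polynomial ℂ}
    (hd : d.degree < m) : IsTransfer (ratTransfer a d) := by
  have hne : ∀ ω : ℝ, ∏ k, (Complex.I * ω - (a k : ℂ)) ≠ 0 := fun ω =>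
    Finset.prod_ne_zero_iff.2 fun k _ => I_mul_sub_ne_zero (ha k) ω
  refine ⟨Continuous.div (by fun_prop) (by fun_prop) hne, ?_⟩
  rcases Nat.eq_zero_or_pos m with rfl | hm
  · have : d = 0 := by simpa [Polynomial.degree_eq_bot] using Nat.WithBot.lt_zero_iff.1 hd
    exact ⟨0, fun ω => by simp [ratTransfer, this]⟩
  have hnat : d.natDegree < m := natDegree_lt_of_degree_lt hm hd
  set B : ℝ := ∏ k, (a k / (1 + a k)) with hB
  have hB0 : 0 < B := Finset.prod_pos fun k _ => div_pos (ha k) (by have := ha k; positivity)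
  refine ⟨(∑ i ∈ Finset.range m, ‖d.coeff i‖) / B, fun ω => ?_⟩
  have hnum : ‖d.eval (Complex.I * ω)‖ ≤
      (∑ i ∈ Finset.range m, ‖d.coeff i‖) * (1 + |ω|) ^ (m - 1) := by
    rw [Polynomial.eval_eq_sum_range' hnat, Finset.sum_mul]
    refine (norm_sum_le _ _).trans (Finset.sum_le_sum fun i hi => ?_)
    rw [norm_mul, norm_pow]
    gcongr
    calc ‖Complex.I * (ω : ℂ)‖ ^ i ≤ (1 + |ω|) ^ i := by
          gcongr
          simp
      _ ≤ (1 + |ω|) ^ (m - 1) :=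
          pow_le_pow_right₀ (by simp) (Nat.le_sub_one_of_lt (Finset.mem_range.1 hi))
  have hden : B * (1 + |ω|) ^ m ≤ ‖∏ k, (Complex.I * ω - (a k : ℂ))‖ := by
    rw [norm_prod, hB]
    calc _ = ∏ k, (a k / (1 + a k) * (1 + |ω|)) := by
          rw [Finset.prod_mul_distrib]; simp
      _ ≤ _ := Finset.prod_le_prod (fun k _ => by have := ha k; positivity)
          fun k _ => norm_I_mul_sub_ge (ha k) ω
  rw [ratTransfer, norm_div]
  refine (div_le_div₀ (by positivity) hnum (by positivity) hden).trans (le_of_eq ?_)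
  obtain ⟨n, rfl⟩ : ∃ n, m = n + 1 := ⟨m - 1, by omega⟩
  rw [Nat.add_sub_cancel, pow_succ]
  field_simp

/-- The transfer function of an anticausal kernel has real coefficients. -/
theorem exists_hasTransfer_of_mem_anticausalKernels {κ : ℝ → ℝ} (hκ : κ ∈ AnticausalKernels) :
    ∃ (m : ℕ) (a : Fin m → ℝ) (d : Polynomial ℝ), (∀ k, 0 < a k) ∧ d.degree < m ∧
      HasTransfer κ (ratTransfer a (d.map Complex.ofRealHom)) := by
  obtain ⟨-, m, a, d, hm, ha, hd, hF⟩ := hκ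
  have hT := isTransfer_ratTransfer ha hd
  have h₁ : HasTransfer κ (ratTransfer a d) := by
    refine ⟨hT, ?_⟩
    rcases hF with ⟨hi, hF⟩ | ⟨h2, hF⟩
    · refine exists_memLp_of_fourier_memLp hi hT.memLp ?_
      funext ξ
      rw [Real.fourier_real_eq_integral_exp_smul]
      refine Eq.trans ?_ (hF (2 * Real.pi * ξ)).symm
      refine integral_congr_ae (.of_forall fun t => ?_)
      simp only [smul_eq_mul]
      congr 2
      push_cast
      ring
    · refine ⟨h2, ?_⟩
      filter_upwards [ae_comp_two_pi_mul hF] with ξ hξ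
      rw [ratTransfer, hξ, fourierL2, mul_div_cancel_left₀ _ (by positivity)]
  -- Real coefficients are needed so that the predicting kernel is real. Taking real parts of the
  -- coefficients averages d(iω) with the conjugate of d(-iω), and these agree almost everywhere
  -- because κ is real.
  set r : Polynomial ℝ := ∑ i ∈ Finset.range m, Polynomial.monomial i (d.coeff i).re with hr
  have hrd : r.degree < m := by
    refine lt_of_le_of_lt (Polynomial.degree_sum_le _ _) ?_
    refine (Finset.sup_lt_iff (WithBot.bot_lt_coe m)).2 fun i hi => ?_
    exact lt_of_le_of_lt (Polynomial.degree_monomial_le _ _)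
      (WithBot.coe_lt_coe.2 (Nat.cast_lt.2 (Finset.mem_range.1 hi)))
  have hnat : d.natDegree < m := natDegree_lt_of_degree_lt hm hd
  have hre : ∀ ω : ℝ, (r.map Complex.ofRealHom).eval (Complex.I * ω) =
      (d.eval (Complex.I * ω) + conj (d.eval (Complex.I * ((-ω : ℝ) : ℂ)))) / 2 := by
    intro ω
    rw [Polynomial.eval_eq_sum_range' hnat, Polynomial.eval_eq_sum_range' hnat, hr,
      Polynomial.eval_map, Polynomial.eval₂_finsetSum, map_sum, ← Finset.sum_add_distrib,
      Finset.sum_div]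
    refine Finset.sum_congr rfl fun i _ => ?_
    simp only [Polynomial.eval₂_monomial, Complex.ofRealHom_eq_coe, map_mul, map_pow,
      Complex.conj_I, Complex.conj_ofReal, Complex.ofReal_neg, mul_neg, neg_mul, neg_neg, map_neg]
    rw [Complex.re_eq_add_conj]
    ring
  have hrT : IsTransfer (ratTransfer a (r.map Complex.ofRealHom)) :=
    isTransfer_ratTransfer ha (lt_of_le_of_lt Polynomial.degree_map_le hrd)
  refine ⟨m, a, r, ha, hrd, hrT, ?_⟩
  obtain ⟨-, h2, hF2⟩ := h₁
  refine ⟨h2, ?_⟩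
  filter_upwards [hF2, (Measure.measurePreserving_neg volume).quasiMeasurePreserving.ae hF2,
    fourier_neg_ae_eq_conj h2] with ξ h3 h4 h5
  rw [h3, h4] at h5
  rw [h3]
  set ω : ℝ := 2 * Real.pi * ξ with hω
  have hneg : 2 * Real.pi * -ξ = -ω := by rw [hω]; ring
  rw [hneg] at h5
  simp only [ratTransfer, map_div₀, map_prod, map_sub, map_mul, Complex.conj_I,
    Complex.conj_ofReal] at h5 ⊢
  have hden : ∏ k, (Complex.I * ((-ω : ℝ) : ℂ) - (a k : ℂ)) ≠ 0 :=
    Finset.prod_ne_zero_iff.2 fun k _ => I_mul_sub_ne_zero (ha k) _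
  rw [show ∏ k, (-Complex.I * (ω : ℂ) - (a k : ℂ)) =
    ∏ k, (Complex.I * ((-ω : ℝ) : ℂ) - (a k : ℂ)) by simp, div_left_inj' hden] at h5
  rw [hre, h5, Complex.conj_conj]
  ring

end WeakPrediction

/-! ### Causal kernels whose Laplace transforms are polynomials in 1/(z + ε) without constant term.
-/

namespace WeakPrediction

open scoped Nat

theorem integrableOn_pow_mul_exp_neg {b : ℝ} (hb : 0 < b) (j : ℕ) :
    IntegrableOn (fun t : ℝ => t ^ j * Real.exp (-(b * t))) (Set.Ioi 0) := by
  have h := integrableOn_rpow_mul_exp_neg_mul_rpow (p := 1) (s := j) (b := b)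
    (by have : (0 : ℝ) ≤ j := j.cast_nonneg
        linarith) one_pos hb
  simpa using h

theorem integrableOn_pow_mul_cexp_neg {z : ℂ} (hz : 0 < z.re) (j : ℕ) :
    IntegrableOn (fun t : ℝ => (t : ℂ) ^ j / (j ! : ℂ) * Complex.exp (-(z * t))) (Set.Ioi 0) := by
  refine ((integrableOn_pow_mul_exp_neg hz j).const_mul ((j ! : ℝ)⁻¹)).mono'
    (by fun_prop) ?_
  filter_upwards [ae_restrict_mem measurableSet_Ioi] with t ht
  have ht : 0 < t := ht
  simp only [norm_mul, norm_div, norm_pow, Complex.norm_real, Complex.norm_natCast,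
    Complex.norm_exp, Real.norm_of_nonneg ht.le]
  refine le_of_eq ?_
  simp
  ring

/-- The Laplace transform of `t ^ j / j!`. -/
theorem integral_pow_mul_cexp_neg {z : ℂ} (hz : 0 < z.re) (j : ℕ) :
    ∫ t in Set.Ioi (0 : ℝ), (t : ℂ) ^ j / (j ! : ℂ) * Complex.exp (-(z * t)) = z⁻¹ ^ (j + 1) := by
  have hz0 : z ≠ 0 := fun h => by simp [h] at hz
  induction j with
  | zero =>
    have := integral_exp_mul_complex_Ioi (a := -z) (by simpa using hz) 0
    simpa using this
  | succ j ih =>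
    have hderiv : ∀ t : ℝ, HasDerivAt
        (fun t : ℝ => (t : ℂ) ^ (j + 1) / ((j + 1)! : ℂ) * Complex.exp (-(z * t)))
        ((t : ℂ) ^ j / (j ! : ℂ) * Complex.exp (-(z * t)) -
          z * ((t : ℂ) ^ (j + 1) / ((j + 1)! : ℂ) * Complex.exp (-(z * t)))) t := by
      intro t
      have h1 : HasDerivAt (fun t : ℝ => (t : ℂ)) 1 t := Complex.ofRealCLM.hasDerivAt
      have h2 := ((h1.pow (j + 1)).div_const ((j + 1)! : ℂ)).mul ((h1.const_mul z).neg.cexp)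
      have hj : (j ! : ℂ) ≠ 0 := by exact_mod_cast j.factorial_ne_zero
      have hj1 : (j : ℂ) + 1 ≠ 0 := by exact_mod_cast j.succ_ne_zero
      refine HasDerivAt.congr_deriv (f' := _) (h2 : _) ?_
      simp only [Nat.factorial_succ, Nat.add_sub_cancel, Pi.pow_apply, Pi.neg_apply]
      push_cast
      field_simp
      ring
    have hint := (integrableOn_pow_mul_cexp_neg hz j).sub
      ((integrableOn_pow_mul_cexp_neg hz (j + 1)).const_mul z)
    have hlim := tendsto_zero_of_hasDerivAt_of_integrableOn_Ioi (a := 0)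
      (fun t _ => hderiv t) hint (integrableOn_pow_mul_cexp_neg hz (j + 1))
    -- The function vanishes at 0 and at infinity, so its derivative integrates to 0: a recursion
    -- from j to j + 1.
    have h := integral_Ioi_of_hasDerivAt_of_tendsto' (a := 0) (fun t _ => hderiv t) hint hlim
    rw [integral_sub (integrableOn_pow_mul_cexp_neg hz j)
      ((integrableOn_pow_mul_cexp_neg hz (j + 1)).const_mul z), integral_const_mul, ih] at h
    simp only [Complex.ofReal_zero, ne_eq, not_false_eq_true, zero_pow,
      zero_div, zero_mul, sub_zero, add_eq_zero, one_ne_zero, and_false] at h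
    rw [pow_succ z⁻¹ (j + 1), eq_mul_inv_iff_mul_eq₀ hz0, mul_comm]
    exact (sub_eq_zero.1 h).symm

/-- The causal kernel `∑ p_j t^j / j! e^{-εt}`, `t ≥ 0`. -/
noncomputable def causalKernel (ε : ℝ) (p : Polynomial ℝ) (t : ℝ) : ℝ :=
  if t < 0 then 0 else
    ∑ j ∈ Finset.range (p.natDegree + 1), p.coeff j * (t ^ j / j ! * Real.exp (-(ε * t)))

/-- The function `w p(w)` of `w = 1 / (z + ε)`, the Laplace transform of `causalKernel ε p`. -/
noncomputable def causalTransfer (ε : ℝ) (p : Polynomial ℝ) (z : ℂ) : ℂ :=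
  (z + ε)⁻¹ * (p.map Complex.ofRealHom).eval (z + ε)⁻¹

theorem causalTransfer_eq_sum (ε : ℝ) (p : Polynomial ℝ) (z : ℂ) :
    causalTransfer ε p z =
      ∑ j ∈ Finset.range (p.natDegree + 1), (p.coeff j : ℂ) * (z + ε)⁻¹ ^ (j + 1) := by
  rw [causalTransfer, Polynomial.eval_map, Polynomial.eval₂_eq_sum_range, Finset.mul_sum]
  refine Finset.sum_congr rfl fun j _ => ?_
  simp only [Complex.ofRealHom_eq_coe, pow_succ]
  ring

theorem causalKernel_eq_indicator (ε : ℝ) (p : Polynomial ℝ) :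
    causalKernel ε p = fun t => ∑ j ∈ Finset.range (p.natDegree + 1), (Set.Ici (0 : ℝ)).indicator
      (fun t => p.coeff j * (t ^ j / j ! * Real.exp (-(ε * t)))) t := by
  funext t
  rw [causalKernel]
  split_ifs with h
  · simp [Set.indicator, not_le.2 h]
  · simp [Set.indicator, not_lt.1 h]

theorem memLp_causalKernel {ε : ℝ} (hε : 0 < ε) (p : Polynomial ℝ) :
    MemLp (causalKernel ε p) 2 := by
  rw [causalKernel_eq_indicator]
  refine memLp_finsetSum _ fun j _ => ?_
  rw [memLp_indicator_iff_restrict measurableSet_Ici, ← restrict_Ioi_eq_restrict_Ici]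
  rw [memLp_two_iff_integrable_sq (by fun_prop)]
  refine ((integrableOn_pow_mul_exp_neg (b := 2 * ε) (by positivity) (2 * j)).const_mul
    ((p.coeff j / j !) ^ 2)).congr (.of_forall fun t => ?_)
  have : Real.exp (-(2 * ε * t)) = Real.exp (-(ε * t)) ^ 2 := by
    rw [← Real.exp_nat_mul]; congr 1; push_cast; ring
  simp only [this]
  ring

theorem integrable_causalKernel {ε : ℝ} (hε : 0 < ε) (p : Polynomial ℝ) :
    Integrable (causalKernel ε p) := by
  rw [causalKernel_eq_indicator]
  refine integrable_finsetSum _ fun j _ => ?_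
  rw [integrable_indicator_iff measurableSet_Ici, integrableOn_Ici_iff_integrableOn_Ioi]
  refine ((integrableOn_pow_mul_exp_neg hε j).const_mul
    (p.coeff j / j !)).congr (.of_forall fun t => ?_)
  ring

/-- The condition allows Re z = 0, so the formula also yields the Fourier transform. -/
theorem laplace_causalKernel {ε : ℝ} (p : Polynomial ℝ) {z : ℂ} (hz : 0 < z.re + ε) :
    laplace (causalKernel ε p) z = causalTransfer ε p z := by
  have hz' : 0 < (z + ε).re := by simpa using hz
  rw [laplace, causalTransfer_eq_sum]
  have h : ∀ t ∈ Set.Ioi (0 : ℝ), Complex.exp (-(z * t)) * (causalKernel ε p t : ℂ) =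
      ∑ j ∈ Finset.range (p.natDegree + 1), (p.coeff j : ℂ) *
        ((t : ℂ) ^ j / (j ! : ℂ) * Complex.exp (-((z + ε) * t))) := by
    intro t ht
    rw [causalKernel, if_neg (not_lt.2 (le_of_lt ht)), Complex.ofReal_sum, Finset.mul_sum]
    refine Finset.sum_congr rfl fun j _ => ?_
    have : Complex.exp (-((z + ε) * t)) = Complex.exp (-(z * t)) * Complex.exp (-(ε * t)) := by
      rw [← Complex.exp_add]; congr 1; ring
    rw [this]
    push_cast
    ring
  rw [setIntegral_congr_fun measurableSet_Ioi h, integral_finsetSum _ fun j _ =>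
    (integrableOn_pow_mul_cexp_neg hz' j).const_mul _]
  refine Finset.sum_congr rfl fun j _ => ?_
  rw [integral_const_mul, integral_pow_mul_cexp_neg hz']

theorem norm_add_ofReal_ge {ε : ℝ} (hε : 0 < ε) {z : ℂ} (hz : 0 ≤ z.re) :
    ε / (1 + ε) * (1 + |z.im|) ≤ ‖z + ε‖ := by
  have h1 : |z.im| ≤ ‖z + ε‖ := by simpa using Complex.abs_im_le_norm (z + ε)
  have h2 : ε ≤ ‖z + ε‖ := by
    have := Complex.abs_re_le_norm (z + ε)
    simp only [Complex.add_re, Complex.ofReal_re] at this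
    exact (le_trans (by linarith) (le_abs_self _)).trans this
  rw [div_mul_eq_mul_div, div_le_iff₀ (by positivity)]
  nlinarith

theorem exists_norm_causalTransfer_le {ε : ℝ} (hε : 0 < ε) (p : Polynomial ℝ) :
    ∃ C : ℝ, 0 ≤ C ∧ ∀ z : ℂ, 0 ≤ z.re → ‖causalTransfer ε p z‖ ≤ C * (1 + |z.im|)⁻¹ := by
  set b : ℝ := (ε / (1 + ε))⁻¹ with hb
  have hb0 : 0 < b := by positivity
  refine ⟨∑ j ∈ Finset.range (p.natDegree + 1), |p.coeff j| * b ^ (j + 1), by positivity,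
    fun z hz => ?_⟩
  rw [causalTransfer_eq_sum, Finset.sum_mul]
  refine (norm_sum_le _ _).trans (Finset.sum_le_sum fun j _ => ?_)
  have hw : ‖(z + ε)⁻¹‖ ≤ b * (1 + |z.im|)⁻¹ := by
    rw [norm_inv, hb, ← mul_inv]
    exact inv_anti₀ (by positivity) (norm_add_ofReal_ge hε hz)
  rw [norm_mul, norm_pow, Complex.norm_real, Real.norm_eq_abs, mul_assoc]
  gcongr
  calc ‖(z + ε)⁻¹‖ ^ (j + 1) ≤ (b * (1 + |z.im|)⁻¹) ^ (j + 1) := by gcongr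
    _ = b ^ (j + 1) * (1 + |z.im|)⁻¹ ^ (j + 1) := mul_pow _ _ _
    _ ≤ b ^ (j + 1) * (1 + |z.im|)⁻¹ := by
        gcongr
        exact pow_le_of_le_one (by positivity) (inv_le_one_of_one_le₀ (by simp)) (by simp)

theorem add_ofReal_ne_zero {ε : ℝ} (hε : 0 < ε) {z : ℂ} (hz : 0 ≤ z.re) : z + ε ≠ 0 := by
  refine norm_pos_iff.1 (lt_of_lt_of_le ?_ (norm_add_ofReal_ge hε hz))
  positivity

theorem memLp_two_inv_one_add_abs : MemLp (fun ω : ℝ => (1 + |ω|)⁻¹) 2 :=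
  (memLp_two_iff_integrable_sq (by fun_prop)).2 integrable_inv_one_add_abs_sq

/-- The bound C / (1 + |Im z|) is uniform in Re z > 0, so one function of Im z dominates all
vertical lines, for r = 2 and r = ∞ alike. -/
theorem memHardy_laplace_causalKernel {ε : ℝ} (hε : 0 < ε) (p : Polynomial ℝ) {r : ℝ≥0∞}
    (hr : MemLp (fun ω : ℝ => (1 + |ω|)⁻¹) r) : MemHardy r (laplace (causalKernel ε p)) := by
  have heq : ∀ z : ℂ, 0 < z.re → laplace (causalKernel ε p) z = causalTransfer ε p z :=
    fun z hz => laplace_causalKernel p (by linarith)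
  refine ⟨DifferentiableOn.congr (f := causalTransfer ε p) ?_ fun z hz => heq z hz, ?_⟩
  · intro z hz
    have h0 := add_ofReal_ne_zero hε (le_of_lt hz)
    have hi : DifferentiableAt ℂ (fun z : ℂ => (z + ε)⁻¹) z := by fun_prop (disch := exact h0)
    exact (hi.mul ((Polynomial.differentiable _).differentiableAt.comp z hi)).differentiableWithinAt
  · obtain ⟨C, hC0, hC⟩ := exists_norm_causalTransfer_le hε p
    refine lt_of_le_of_lt (iSup₂_le fun s hs => ?_) (hr.const_mul C).2
    refine eLpNorm_mono_real fun ω => ?_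
    rw [heq _ (by simpa using hs)]
    simpa using hC (s + Complex.I * ω) (by simpa using hs.le)

theorem causalKernel_mem {ε : ℝ} (hε : 0 < ε) (p : Polynomial ℝ) :
    causalKernel ε p ∈ CausalKernels := by
  refine ⟨memLp_causalKernel hε p, fun t ht => if_pos ht,
    memHardy_laplace_causalKernel hε p memLp_two_inv_one_add_abs,
    memHardy_laplace_causalKernel hε p ?_⟩
  refine memLp_top_of_bound memLp_two_inv_one_add_abs.1 1 (.of_forall fun ω => ?_)
  rw [Real.norm_of_nonneg (by positivity)]
  exact inv_le_one_of_one_le₀ (by simp)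

theorem hasTransfer_causalKernel {ε : ℝ} (hε : 0 < ε) (p : Polynomial ℝ) :
    HasTransfer (causalKernel ε p) fun ω => causalTransfer ε p (Complex.I * ω) := by
  have hT : IsTransfer fun ω : ℝ => causalTransfer ε p (Complex.I * ω) := by
    constructor
    · have hi : Continuous fun ω : ℝ => (Complex.I * (ω : ℂ) + ε)⁻¹ :=
        Continuous.inv₀ (by fun_prop) fun ω => add_ofReal_ne_zero hε (by simp)
      exact hi.mul ((Polynomial.continuous _).comp hi)
    · obtain ⟨C, -, hC⟩ := exists_norm_causalTransfer_le hε p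
      exact ⟨C, fun ω => by simpa using hC (Complex.I * ω) (by simp)⟩
  refine ⟨hT, exists_memLp_of_fourier_memLp (integrable_causalKernel hε p).ofReal hT.memLp ?_⟩
  funext ξ
  beta_reduce
  rw [← laplace_causalKernel p (by simpa using hε), laplace,
    Real.fourier_real_eq_integral_exp_smul, ← integral_Ici_eq_integral_Ioi,
    setIntegral_eq_integral_of_forall_compl_eq_zero]
  · refine integral_congr_ae (.of_forall fun t => ?_)
    simp only [smul_eq_mul]
    congr 2
    push_cast
    ring
  · intro t ht
    simp [causalKernel, show t < 0 from not_le.1 ht]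

end WeakPrediction

/-! ### Damping functions: cancellation of poles and size on the imaginary axis. -/

namespace WeakPrediction

/-- The function `1 - ε (z - a) / (z + ε)` at `z = iω`. -/
noncomputable def factor (a ε ω : ℝ) : ℂ := 1 - ε + ε * (a + ε) * (Complex.I * ω + ε)⁻¹

/-- A function of `z = iω` that equals `1` at `z = a`, vanishes at infinity and is small away from
`z = 0` for large `n` and small `ε`. -/
noncomputable def damping (a ε : ℝ) (n : ℕ) (ω : ℝ) : ℂ :=
  factor a ε ω ^ n * ((a + ε) * (Complex.I * ω + ε)⁻¹)

-- The damping is a polynomial g in w = 1/(z + ε) with g = 1 at w = 1/(a + ε), that is, at z = a.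
-- The root of 1 - g there splits off, and w - 1/(a + ε) = -(z - a)w/(a + ε).
open Polynomial in
theorem exists_one_sub_damping_eq {a ε : ℝ} (ha : 0 < a) (hε : 0 < ε) (n : ℕ) :
    ∃ r : Polynomial ℝ, ∀ ω : ℝ, 1 - damping a ε n ω = (Complex.I * ω - a) *
      ((Complex.I * ω + ε)⁻¹ * (r.map Complex.ofRealHom).eval (Complex.I * (ω : ℂ) + ε)⁻¹) := by
  set g : Polynomial ℝ := (C (1 - ε) + C (ε * (a + ε)) * X) ^ n * (C (a + ε) * X) with hg
  have h0 : a + ε ≠ 0 := by positivity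
  have hroot : (1 - g).IsRoot (a + ε)⁻¹ := by
    simp [IsRoot, hg, mul_assoc, h0]
  obtain ⟨s, hs⟩ := dvd_iff_isRoot.2 hroot
  refine ⟨-C (a + ε)⁻¹ * s, fun ω => ?_⟩
  set w : ℂ := (Complex.I * (ω : ℂ) + ε)⁻¹ with hw
  have hz : Complex.I * (ω : ℂ) + ε ≠ 0 := add_ofReal_ne_zero hε (by simp)
  have hzw : (Complex.I * (ω : ℂ) + ε) * w = 1 := mul_inv_cancel₀ hz
  have h0' : (a : ℂ) + ε ≠ 0 := by exact_mod_cast h0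
  have h1 : 1 - damping a ε n ω = ((1 - g).map Complex.ofRealHom).eval w := by
    simp [damping, factor, hg, ← hw]
  rw [h1, hs]
  simp only [Polynomial.map_mul, Polynomial.map_sub, Polynomial.map_X, Polynomial.map_C,
    Polynomial.map_neg, eval_mul, eval_sub, eval_X, eval_C, eval_neg, Complex.ofRealHom_eq_coe]
  push_cast
  field_simp
  linear_combination (s.map Complex.ofRealHom).eval w * hzw

open Polynomial in
/-- Multiplying by `∏ (1 - damping)` cancels all the poles in the right half-plane. -/
theorem exists_causalTransfer_eq {m : ℕ} {a : Fin m → ℝ} (ha : ∀ k, 0 < a k) {d : Polynomial ℝ}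
    (hd : d.degree < m) {ε : ℝ} (hε : 0 < ε) (n : ℕ) :
    ∃ p : Polynomial ℝ, ∀ ω : ℝ, causalTransfer ε p (Complex.I * ω) =
      ratTransfer a (d.map Complex.ofRealHom) ω * ∏ k, (1 - damping (a k) ε n ω) := by
  choose r hr using fun k => exists_one_sub_damping_eq (ha k) hε n
  -- After cancellation d(z) w^m ∏ r_k(w) remains. Since zw = 1 - εw, each z^i w^m equals (1 - εw)^i
  -- w^(m-i), and i < m leaves one w to factor out.
  refine ⟨(∑ i ∈ Finset.range m, C (d.coeff i) * (1 - C ε * X) ^ i * X ^ (m - 1 - i)) * ∏ k, r k,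
    fun ω => ?_⟩
  set w : ℂ := (Complex.I * (ω : ℂ) + ε)⁻¹ with hw
  have hz : Complex.I * (ω : ℂ) + ε ≠ 0 := add_ofReal_ne_zero hε (by simp)
  have hzw : 1 - ε * w = Complex.I * ω * w := by
    have : (Complex.I * (ω : ℂ) + ε) * w = 1 := mul_inv_cancel₀ hz
    linear_combination -this
  have hne : ∏ k, (Complex.I * (ω : ℂ) - (a k : ℂ)) ≠ 0 :=
    Finset.prod_ne_zero_iff.2 fun k _ => I_mul_sub_ne_zero (ha k) ω
  have hdeg : (d.map Complex.ofRealHom).eval (Complex.I * ω) =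
      ∑ i ∈ Finset.range m, (d.coeff i : ℂ) * (Complex.I * ω) ^ i := by
    rcases Nat.eq_zero_or_pos m with rfl | hm
    · have : d = 0 := by simpa [Polynomial.degree_eq_bot] using Nat.WithBot.lt_zero_iff.1 hd
      simp [this]
    · rw [eval_map, eval₂_eq_sum_range' _ (natDegree_lt_of_degree_lt hm hd)]
      simp
  simp only [hr, Finset.prod_mul_distrib, ← hw, Finset.prod_const, Finset.card_univ,
    Fintype.card_fin, ratTransfer, causalTransfer, Polynomial.map_mul, eval_mul,
    Polynomial.map_prod, eval_prod]
  rw [div_mul_eq_mul_div, mul_left_comm _ (∏ k, (Complex.I * (ω : ℂ) - (a k : ℂ))),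
    mul_div_cancel_left₀ _ hne, ← mul_assoc, ← mul_assoc]
  congr 1
  rw [hdeg, Polynomial.map_sum, eval_finsetSum, Finset.mul_sum, Finset.sum_mul]
  refine Finset.sum_congr rfl fun i hi => ?_
  have him : m = (m - 1 - i) + i + 1 := by have := Finset.mem_range.1 hi; omega
  simp only [Polynomial.map_mul, Polynomial.map_sub, Polynomial.map_pow, Polynomial.map_X,
    Polynomial.map_C, Polynomial.map_one, eval_mul, eval_sub, eval_X, eval_C, eval_pow, eval_one,
    Complex.ofRealHom_eq_coe, hzw]
  conv_rhs => rw [him]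
  ring

theorem normSq_I_mul_add (ω ε : ℝ) : ‖Complex.I * ω + (ε : ℂ)‖ ^ 2 = ω ^ 2 + ε ^ 2 := by
  rw [Complex.sq_norm, Complex.normSq_apply]
  simp
  ring

/-- The factor is ((1 - ε)z + ε(1 + a))/(z + ε), so its squared modulus on the axis is explicit; 1 +
x ≤ e^x then prepares for taking powers. -/
theorem norm_factor_sq_le {a ε B ω : ℝ} (ha : 0 < a) (haB : a ≤ B) (hε : 0 < ε) (hε1 : ε ≤ 1) :
    ‖factor a ε ω‖ ^ 2 ≤
      Real.exp (-(ε * (ω ^ 2 - ε * (2 * B + B ^ 2)) / (ω ^ 2 + ε ^ 2))) := by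
  have hz : Complex.I * (ω : ℂ) + ε ≠ 0 := add_ofReal_ne_zero hε (by simp)
  have hD : 0 < ω ^ 2 + ε ^ 2 := by positivity
  have h1 : factor a ε ω =
      (Complex.I * ((1 - ε) * ω : ℝ) + (ε * (1 + a) : ℝ)) / (Complex.I * ω + ε) := by
    rw [factor]
    field_simp
    push_cast
    ring
  rw [h1, norm_div, div_pow, normSq_I_mul_add, normSq_I_mul_add]
  refine le_trans ?_ (Real.add_one_le_exp _)
  rw [← neg_div, div_add_one hD.ne']
  refine (div_le_div_iff_of_pos_right hD).2 ?_
  have h2 : ε * (ω ^ 2 * (1 - ε)) ≥ 0 := by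
    have : 0 ≤ 1 - ε := by linarith
    positivity
  have h3 : ε ^ 2 * (2 * a + a ^ 2) ≤ ε ^ 2 * (2 * B + B ^ 2) := by gcongr
  nlinarith

theorem norm_factor_pow_sq_le {a ε B ω : ℝ} (ha : 0 < a) (haB : a ≤ B) (hε : 0 < ε)
    (hε1 : ε ≤ 1) {n : ℕ} {γ : ℝ} (hn : n * ε = γ) :
    ‖factor a ε ω ^ n‖ ^ 2 ≤
      Real.exp (-(γ * (ω ^ 2 - ε * (2 * B + B ^ 2)) / (ω ^ 2 + ε ^ 2))) := by
  rw [norm_pow, ← pow_mul, mul_comm, pow_mul]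
  refine (pow_le_pow_left₀ (by positivity) (norm_factor_sq_le ha haB hε hε1) n).trans
    (le_of_eq ?_)
  rw [← Real.exp_nat_mul, ← hn]
  congr 1
  ring

theorem norm_factor_pow_le_one {a ε B ω : ℝ} (ha : 0 < a) (haB : a ≤ B) (hε : 0 < ε)
    (hε1 : ε ≤ 1) (h : ε * (2 * B + B ^ 2) ≤ ω ^ 2) (n : ℕ) : ‖factor a ε ω ^ n‖ ≤ 1 := by
  have := norm_factor_pow_sq_le ha haB hε hε1 (ω := ω) (n := n) rfl
  refine (sq_le_one_iff₀ (norm_nonneg _)).1 (this.trans (Real.exp_le_one_iff.2 ?_))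
  have h2 : 0 ≤ ω ^ 2 - ε * (2 * B + B ^ 2) := by linarith
  have : 0 ≤ n * ε * (ω ^ 2 - ε * (2 * B + B ^ 2)) / (ω ^ 2 + ε ^ 2) := by positivity
  linarith

/-- The choice of `ε = 1 / M` in dependence on `γ`: this is where `q > 1` is used. -/
theorem exists_norm_factor_pow_le {q c B : ℝ} (hq : 1 < q) (hc : 0 < c) (hB : 0 < B) (γ : ℕ) :
    ∃ M : ℕ, γ < M ∧ ∀ a : ℝ, 0 < a → a ≤ B → ∀ ω : ℝ, ω ≠ 0 →
      ‖factor a (M : ℝ)⁻¹ ω ^ (γ * M)‖ ≤ Real.exp (c / |ω| ^ q) ∧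
      (1 ≤ |ω| → ‖factor a (M : ℝ)⁻¹ ω ^ (γ * M)‖ ≤ 1) := by
  set A : ℝ := 2 * B + B ^ 2 with hA
  have hA0 : 0 < A := by positivity
  -- As q - 1 > 0, near 0 the growth γA/|ω| is below c/|ω|^q.
  obtain ⟨δ, hδ0, hδ⟩ : ∃ δ : ℝ, 0 < δ ∧ ∀ ω : ℝ, 0 < ω → ω < δ → γ * A * ω ^ (q - 1) ≤ c := by
    have hcont : Tendsto (fun ω : ℝ => γ * A * ω ^ (q - 1)) (𝓝 0) (𝓝 (γ * A * 0 ^ (q - 1))) :=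
      ((Real.continuous_rpow_const (by linarith)).tendsto 0).const_mul _
    rw [Real.zero_rpow (by linarith), mul_zero] at hcont
    obtain ⟨δ, hδ, h⟩ := Metric.eventually_nhds_iff.1 (hcont.eventually (ge_mem_nhds hc))
    exact ⟨δ, hδ, fun ω h0 h1 => h (by simpa [abs_of_pos h0] using h1)⟩
  -- With ε = 1/M, the set ω² < εA where the factor may exceed 1 lies inside |ω| < min(δ, 1).
  obtain ⟨M, hM1, hM2⟩ : ∃ M : ℕ, γ < M ∧ (M : ℝ)⁻¹ * A < (min δ 1) ^ 2 := by
    have hlim : Tendsto (fun M : ℕ => (M : ℝ)⁻¹ * A) atTop (𝓝 (0 * A)) :=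
      tendsto_inv_atTop_nhds_zero_nat.mul_const A
    rw [zero_mul] at hlim
    exact ((eventually_gt_atTop γ).and (hlim.eventually (gt_mem_nhds (by positivity)))).exists
  have hM0 : 0 < M := by omega
  have hMr : (0 : ℝ) < M := by exact_mod_cast hM0
  set ε : ℝ := (M : ℝ)⁻¹ with hεdef
  have hε : 0 < ε := by positivity
  have hε1 : ε ≤ 1 := inv_le_one_of_one_le₀ (by exact_mod_cast hM0)
  have hn : ((γ * M : ℕ) : ℝ) * ε = γ := by
    rw [hεdef]
    push_cast
    field_simp
  have hsmall : ε * A < δ ^ 2 := hM2.trans_le (by gcongr; exact min_le_left _ _)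
  have hsmall1 : ε * A < 1 := hM2.trans_le (pow_le_one₀ (by positivity) (min_le_right _ _))
  refine ⟨M, hM1, fun a ha haB ω hω => ⟨?_, fun h1 => ?_⟩⟩
  · have hω0 : 0 < |ω| := abs_pos.2 hω
    have hpos : 0 < |ω| ^ q := Real.rpow_pos_of_pos hω0 _
    rcases le_or_gt (ε * A) (ω ^ 2) with h | h
    · exact (norm_factor_pow_le_one ha haB hε hε1 h _).trans (Real.one_le_exp (by positivity))
    · have hlt : |ω| < δ := by
        refine lt_of_pow_lt_pow_left₀ 2 hδ0.le ?_
        rw [sq_abs]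
        linarith
      have hkey : γ * A / |ω| ≤ c / |ω| ^ q := by
        rw [div_le_div_iff₀ hω0 hpos, show |ω| ^ q = |ω| ^ (q - 1) * |ω| by
          rw [← Real.rpow_add_one hω0.ne']; ring_nf, ← mul_assoc]
        gcongr
        exact hδ _ hω0 hlt
      have hsq := norm_factor_pow_sq_le ha haB hε hε1 (ω := ω) hn
      have hexp : -(γ * (ω ^ 2 - ε * A) / (ω ^ 2 + ε ^ 2)) ≤ 2 * (c / |ω| ^ q) := by
        have h1 : -(γ * (ω ^ 2 - ε * A) / (ω ^ 2 + ε ^ 2)) ≤ γ * A / |ω| := by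
          rw [← neg_div, div_le_div_iff₀ (by positivity) hω0]
          -- This makes the growth bound independent of ε: γεA/(ω² + ε²) ≤ γA/|ω|.
          have h2 : ε * |ω| ≤ ω ^ 2 + ε ^ 2 := by
            nlinarith [sq_nonneg (|ω| - ε), sq_abs ω]
          have h3 : (γ : ℝ) * A * (ε * |ω|) ≤ γ * A * (ω ^ 2 + ε ^ 2) := by gcongr
          have h4 : 0 ≤ (γ : ℝ) * ω ^ 2 * |ω| := by positivity
          nlinarith
        have : 0 ≤ c / |ω| ^ q := by positivity
        linarith
      refine (sq_le_sq₀ (norm_nonneg _) (Real.exp_pos _).le).1 ?_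
      rw [← Real.exp_nat_mul]
      refine hsq.trans (Real.exp_le_exp.2 ?_)
      simpa using hexp
  · refine norm_factor_pow_le_one ha haB hε hε1 ?_ _
    have : 1 ≤ ω ^ 2 := by rw [← sq_abs]; exact one_le_pow₀ h1
    exact hsmall1.le.trans this

theorem norm_inv_I_mul_add_le {ε ω : ℝ} (hω : ω ≠ 0) :
    ‖(Complex.I * (ω : ℂ) + ε)⁻¹‖ ≤ |ω|⁻¹ := by
  rw [norm_inv]
  refine inv_anti₀ (abs_pos.2 hω) ?_
  simpa using Complex.abs_im_le_norm (Complex.I * (ω : ℂ) + ε)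

theorem norm_damping_le {a ε B ω : ℝ} (ha : 0 < a) (haB : a ≤ B) (hε : 0 < ε) (hε1 : ε ≤ 1)
    (hω : ω ≠ 0) (n : ℕ) :
    ‖damping a ε n ω‖ ≤ ‖factor a ε ω ^ n‖ * ((B + 1) * |ω|⁻¹) := by
  rw [damping, norm_mul, norm_mul]
  have hB : 0 ≤ B + 1 := by linarith
  gcongr
  · rw [← Complex.ofReal_add, Complex.norm_real, Real.norm_of_nonneg (by positivity)]
    linarith
  · exact norm_inv_I_mul_add_le hω

theorem norm_prod_one_sub_sub_one_le {ι : Type*} (s : Finset ι) (G : ι → ℂ) {g : ℝ} (hg : 0 ≤ g)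
    (h : ∀ k ∈ s, ‖G k‖ ≤ g) :
    ‖1 - ∏ k ∈ s, (1 - G k)‖ ≤ s.card * (g * (1 + g) ^ s.card) := by
  classical
  induction s using Finset.induction_on with
  | empty => simp
  | insert i s hi ih =>
    have ih := ih fun k hk => h k (Finset.mem_insert_of_mem hk)
    have hi' := h i (Finset.mem_insert_self i s)
    have hone : 1 ≤ 1 + g := by linarith
    have hprod : ‖∏ k ∈ s, (1 - G k)‖ ≤ (1 + g) ^ s.card := by
      rw [norm_prod, ← Finset.prod_const]
      refine Finset.prod_le_prod (fun _ _ => norm_nonneg _) fun k hk => ?_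
      refine (norm_sub_le _ _).trans ?_
      simpa using h k (Finset.mem_insert_of_mem hk)
    rw [Finset.prod_insert hi, Finset.card_insert_of_notMem hi, show
      1 - (1 - G i) * ∏ k ∈ s, (1 - G k) = (1 - ∏ k ∈ s, (1 - G k)) + G i * ∏ k ∈ s, (1 - G k) by
        ring]
    refine (norm_add_le _ _).trans ?_
    rw [norm_mul]
    have h1 : (1 + g) ^ s.card ≤ (1 + g) ^ (s.card + 1) := pow_le_pow_right₀ hone (Nat.le_succ _)
    calc _ ≤ s.card * (g * (1 + g) ^ s.card) + g * (1 + g) ^ s.card := by gcongr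
      _ ≤ s.card * (g * (1 + g) ^ (s.card + 1)) + g * (1 + g) ^ (s.card + 1) := by gcongr
      _ = _ := by push_cast; ring

end WeakPrediction

/-! ### Weighted approximation by dominated convergence. -/

namespace WeakPrediction

/-- Dominated convergence to zero in `L_r`, `0 < r < ∞`. -/
theorem tendsto_eLpNorm_zero_of_dominated {f : ℕ → ℝ → ℝ} {g : ℝ → ℝ} {r : ℝ≥0∞} (hr0 : r ≠ 0)
    (hr : r ≠ ∞) (hf : ∀ n, AEStronglyMeasurable (f n) volume) (hg : MemLp g r)
    (h : ∀ n, ∀ᵐ t, ‖f n t‖ ≤ g t) (hlim : ∀ᵐ t, Tendsto (fun n => f n t) atTop (𝓝 0)) :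
    Tendsto (fun n => eLpNorm (f n) r volume) atTop (𝓝 0) := by
  have hr' : 0 < r.toReal := ENNReal.toReal_pos hr0 hr
  simp only [eLpNorm_eq_lintegral_rpow_enorm_toReal hr0 hr]
  have key : Tendsto (fun n => ∫⁻ t, ‖f n t‖ₑ ^ r.toReal) atTop
      (𝓝 (∫⁻ _ : ℝ, (0 : ℝ≥0∞))) := by
    refine tendsto_lintegral_of_dominated_convergence' (fun t => ‖g t‖ₑ ^ r.toReal)
      (fun n => (hf n).enorm.pow_const _) (fun n => ?_)
      (lintegral_rpow_enorm_lt_top_of_eLpNorm_lt_top hr0 hr hg.2).ne ?_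
    · filter_upwards [h n] with t ht
      gcongr
      exact enorm_le_iff_norm_le.2 (ht.trans (le_abs_self _))
    · filter_upwards [hlim] with t ht
      have h1 := ((continuous_enorm.tendsto (0 : ℝ)).comp ht)
      have h2 := ((ENNReal.continuous_rpow_const (y := r.toReal)).tendsto _).comp h1
      simpa [Function.comp_def, ENNReal.zero_rpow_of_pos hr'] using h2
  rw [lintegral_zero] at key
  have h3 := ((ENNReal.continuous_rpow_const (y := 1 / r.toReal)).tendsto _).comp key
  simpa [Function.comp_def, ENNReal.zero_rpow_of_pos (inv_pos.2 hr')] using h3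

/-- The weight absorbs the product of the damping factors near `ω = 0`. -/
theorem exists_norm_one_sub_prod_div_weight_le {q c B : ℝ} (hq : 1 < q) (hc : 0 < c) (hB : 0 < B)
    (m : ℕ) : ∃ D : ℝ, 0 ≤ D ∧ ∀ (G : Fin m → ℂ) (ω E : ℝ), ω ≠ 0 → 0 ≤ E →
      E ≤ Real.exp (c / (2 * (m + 1)) / |ω| ^ q) → (1 ≤ |ω| → E ≤ 1) →
      (∀ k, ‖G k‖ ≤ E * ((B + 1) * |ω|⁻¹)) →
      ‖1 - ∏ k, (1 - G k)‖ / weight ω q c ≤ D * (1 + |ω|)⁻¹ := by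
  -- The weight is e^{2(m+1)} with e = exp(s/|ω|^q): m + 1 factors e pay for powers of E, the other
  -- m + 1 for powers of 1/|ω|.
  set s : ℝ := c / (2 * (m + 1)) with hs
  have hs0 : 0 < s := by positivity
  set L : ℝ := 1 + (B + 1) / s with hL
  refine ⟨2 * (m * ((B + 1) * (B + 2) ^ m)) + 2 * (m * L ^ (m + 1)), by positivity,
    fun G ω E hω hE hE1 hE2 hG => ?_⟩
  have hω0 : 0 < |ω| := abs_pos.2 hω
  set u : ℝ := |ω|⁻¹ with hu
  have hu0 : 0 < u := by positivity
  have hprod := norm_prod_one_sub_sub_one_le Finset.univ G (g := E * ((B + 1) * u))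
    (by positivity) fun k _ => hG k
  rw [Finset.card_univ, Fintype.card_fin] at hprod
  have hw := weight_pos ω q c
  have hw1 : 1 ≤ weight ω q c := Real.one_le_exp (by positivity)
  rcases le_or_gt 1 |ω| with h1 | h1
  · have hu1 : u ≤ 1 := inv_le_one_of_one_le₀ h1
    have hE1' := hE2 h1
    have hu2 : u ≤ 2 * (1 + |ω|)⁻¹ := by
      rw [hu, ← div_eq_mul_inv, ← one_div, div_le_div_iff₀ hω0 (by positivity)]
      linarith
    have hEu : E * ((B + 1) * u) ≤ (B + 1) * u := mul_le_of_le_one_left (by positivity) hE1'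
    have hEu' : 1 + E * ((B + 1) * u) ≤ B + 2 := by nlinarith
    calc ‖1 - ∏ k, (1 - G k)‖ / weight ω q c ≤ ‖1 - ∏ k, (1 - G k)‖ :=
          div_le_self (norm_nonneg _) hw1
      _ ≤ m * (E * ((B + 1) * u) * (1 + E * ((B + 1) * u)) ^ m) := hprod
      _ ≤ m * ((B + 1) * u * (B + 2) ^ m) := by gcongr
      _ ≤ m * ((B + 1) * (2 * (1 + |ω|)⁻¹) * (B + 2) ^ m) := by gcongr
      _ = 2 * (m * ((B + 1) * (B + 2) ^ m)) * (1 + |ω|)⁻¹ := by ring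
      _ ≤ _ := by
          gcongr
          have : 0 ≤ 2 * (m * L ^ (m + 1)) := by positivity
          linarith
  · set e : ℝ := Real.exp (s / |ω| ^ q) with he
    have he1 : 1 ≤ e := Real.one_le_exp (by positivity)
    have hpow : |ω| ^ q ≤ |ω| := by
      simpa using Real.rpow_le_rpow_of_exponent_ge hω0 h1.le hq.le
    have hwe : weight ω q c = (e ^ (m + 1)) ^ 2 := by
      rw [weight, he, ← pow_mul, ← Real.exp_nat_mul]
      congr 1
      rw [hs]
      push_cast
      field_simp
    -- For |ω| < 1, 1 + s/|ω| ≤ 1 + s/|ω|^q ≤ e; the constant L trades s for B + 1.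
    have hLu : 1 + (B + 1) * u ≤ L * e := by
      have h2 : s * u ≤ s / |ω| ^ q := by
        rw [hu, ← div_eq_mul_inv]
        gcongr
      have h3 : 1 + s * u ≤ e := by
        have := Real.add_one_le_exp (s / |ω| ^ q)
        linarith
      have h4 : 1 + (B + 1) * u ≤ L * (1 + s * u) := by
        have : L * (1 + s * u) = 1 + (B + 1) * u + s * u + (B + 1) / s := by
          rw [hL]
          field_simp
          ring
        rw [this]
        have : 0 ≤ s * u + (B + 1) / s := by positivity
        linarith
      exact h4.trans (by gcongr)
    have hg : E * ((B + 1) * u) ≤ e * ((B + 1) * u) := by gcongr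
    have hg1 : 1 + E * ((B + 1) * u) ≤ e * (1 + (B + 1) * u) := by linarith
    have hg2 : E * ((B + 1) * u) ≤ e * (1 + (B + 1) * u) := by linarith
    have hfin : ‖1 - ∏ k, (1 - G k)‖ / weight ω q c ≤ m * L ^ (m + 1) := by
      rw [div_le_iff₀ hw, hwe]
      calc _ ≤ m * (E * ((B + 1) * u) * (1 + E * ((B + 1) * u)) ^ m) := hprod
        _ ≤ m * (e * (1 + (B + 1) * u) * (e * (1 + (B + 1) * u)) ^ m) := by gcongr
        _ ≤ m * (e * (L * e) * (e * (L * e)) ^ m) := by gcongr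
        _ = m * L ^ (m + 1) * (e ^ (m + 1)) ^ 2 := by rw [← pow_succ', mul_pow, mul_pow]; ring
    refine hfin.trans ?_
    have h5 : 1 ≤ 2 * (1 + |ω|)⁻¹ := by
      rw [← div_eq_mul_inv, le_div_iff₀ (by positivity)]
      linarith
    calc m * L ^ (m + 1) ≤ m * L ^ (m + 1) * (2 * (1 + |ω|)⁻¹) :=
          le_mul_of_one_le_right (by positivity) h5
      _ = 2 * (m * L ^ (m + 1)) * (1 + |ω|)⁻¹ := by ring
      _ ≤ _ := by
          gcongr
          have : 0 ≤ 2 * (m * ((B + 1) * (B + 2) ^ m)) := by positivity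
          linarith

/-- For fixed ω ≠ 0, once εA < ω²/2 the exponent is at most -sγ with s > 0 independent of γ. The
remaining factor is at most (B + 1)/|ω|. -/
theorem tendsto_damping_zero {a B ω : ℝ} (ha : 0 < a) (haB : a ≤ B) (hω : ω ≠ 0) {M : ℕ → ℕ}
    (hM : ∀ γ, γ < M γ) :
    Tendsto (fun γ => damping a (M γ : ℝ)⁻¹ (γ * M γ) ω) atTop (𝓝 0) := by
  have hM0 : ∀ γ, (0 : ℝ) < M γ := fun γ => by exact_mod_cast (Nat.zero_le γ).trans_lt (hM γ)
  have hε1 : ∀ γ, (M γ : ℝ)⁻¹ ≤ 1 := fun γ =>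
    inv_le_one_of_one_le₀ (by exact_mod_cast (Nat.zero_le γ).trans_lt (hM γ))
  have hεlim : Tendsto (fun γ => (M γ : ℝ)⁻¹) atTop (𝓝 0) := by
    refine tendsto_inv_atTop_zero.comp (tendsto_natCast_atTop_atTop.comp ?_)
    exact tendsto_atTop_mono (fun γ => (hM γ).le) tendsto_id
  set A : ℝ := 2 * B + B ^ 2 with hA
  set s : ℝ := ω ^ 2 / 2 / (ω ^ 2 + 1) with hs
  have hω2 : 0 < ω ^ 2 := by positivity
  have hs0 : 0 < s := by positivity
  have hsmall : ∀ᶠ γ in atTop, (M γ : ℝ)⁻¹ * A < ω ^ 2 / 2 := by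
    have := hεlim.mul_const A
    rw [zero_mul] at this
    exact this.eventually (gt_mem_nhds (by positivity))
  have hsq : ∀ᶠ γ : ℕ in atTop,
      ‖factor a (M γ : ℝ)⁻¹ ω ^ (γ * M γ)‖ ^ 2 ≤ Real.exp (-(s * γ)) := by
    filter_upwards [hsmall] with γ hγ
    have hε0 : 0 < (M γ : ℝ)⁻¹ := inv_pos.2 (hM0 γ)
    refine (norm_factor_pow_sq_le ha haB hε0 (hε1 γ) (γ := γ) ?_).trans (Real.exp_le_exp.2 ?_)
    · push_cast
      have := (hM0 γ).ne'
      field_simp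
    · rw [neg_le_neg_iff, mul_comm, mul_div_assoc]
      gcongr
      rw [hs]
      refine div_le_div₀ (by linarith) (by linarith) (by positivity) ?_
      have : ((M γ : ℝ)⁻¹) ^ 2 ≤ 1 := pow_le_one₀ hε0.le (hε1 γ)
      linarith
  have hsq0 : Tendsto (fun γ : ℕ => ‖factor a (M γ : ℝ)⁻¹ ω ^ (γ * M γ)‖ ^ 2) atTop (𝓝 0) := by
    refine squeeze_zero' (.of_forall fun γ => by positivity) hsq ?_
    refine Real.tendsto_exp_neg_atTop_nhds_zero.comp ?_
    exact tendsto_natCast_atTop_atTop.const_mul_atTop hs0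
  have hn0 : Tendsto (fun γ : ℕ => ‖factor a (M γ : ℝ)⁻¹ ω ^ (γ * M γ)‖) atTop (𝓝 0) := by
    have := (Real.continuous_sqrt.tendsto 0).comp hsq0
    simpa [Function.comp_def, Real.sqrt_sq (norm_nonneg _)] using this
  refine squeeze_zero_norm (fun γ => norm_damping_le ha haB (inv_pos.2 (hM0 γ)) (hε1 γ) hω _) ?_
  simpa using hn0.mul_const ((B + 1) * |ω|⁻¹)

theorem measurable_weight (q c : ℝ) : Measurable fun ω : ℝ => weight ω q c := by
  unfold weight
  fun_prop

/-- Rational transfer functions with poles in the right half-plane are approximated by transfer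
functions of causal kernels, in the norms weighted by `1 / weight`. -/
theorem exists_causalTransfer_approx {q c : ℝ} (hq : 1 < q) (hc : 0 < c) {m : ℕ} {a : Fin m → ℝ}
    (ha : ∀ k, 0 < a k) {d : Polynomial ℝ} (hd : d.degree < m) {η : ℝ≥0∞} (hη : η ≠ 0) :
    ∃ (ε : ℝ) (p : Polynomial ℝ), 0 < ε ∧ ∀ r : ℝ≥0∞, r = 1 ∨ r = 2 →
      eLpNorm (fun ξ : ℝ => ‖ratTransfer a (d.map Complex.ofRealHom) (2 * Real.pi * ξ) -
        causalTransfer ε p (Complex.I * (2 * Real.pi * ξ : ℝ))‖ /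
          weight (2 * Real.pi * ξ) q c) r volume ≤ η := by
  obtain ⟨B, hB, haB⟩ : ∃ B : ℝ, 0 < B ∧ ∀ k, a k ≤ B := by
    have h0 : 0 ≤ ∑ k, a k := Finset.sum_nonneg fun k _ => (ha k).le
    refine ⟨1 + ∑ k, a k, by linarith, fun k => ?_⟩
    have := Finset.single_le_sum (fun k _ => (ha k).le) (Finset.mem_univ k)
    linarith
  choose M hM hMb using exists_norm_factor_pow_le (c := c / (2 * (m + 1))) hq (by positivity) hB
  have hM0 : ∀ γ, (0 : ℝ) < (M γ : ℝ)⁻¹ := fun γ =>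
    inv_pos.2 (by exact_mod_cast (Nat.zero_le γ).trans_lt (hM γ))
  have hM1 : ∀ γ, (M γ : ℝ)⁻¹ ≤ 1 := fun γ =>
    inv_le_one_of_one_le₀ (by exact_mod_cast (Nat.zero_le γ).trans_lt (hM γ))
  choose p hp using fun γ => exists_causalTransfer_eq ha hd (hM0 γ) (γ * M γ)
  set K : ℝ → ℂ := ratTransfer a (d.map Complex.ofRealHom) with hK
  have hKT : IsTransfer K :=
    isTransfer_ratTransfer ha (lt_of_le_of_lt Polynomial.degree_map_le hd)
  obtain ⟨C, hC⟩ := hKT.2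
  have hC0 : 0 ≤ C := by simpa using (norm_nonneg _).trans (hC 0)
  obtain ⟨D, hD0, hD⟩ := exists_norm_one_sub_prod_div_weight_le hq hc hB m
  set err : ℕ → ℝ → ℝ := fun γ ω =>
    ‖K ω - causalTransfer (M γ : ℝ)⁻¹ (p γ) (Complex.I * ω)‖ / weight ω q c with herr
  have herr_eq : ∀ γ ω, err γ ω =
      ‖K ω‖ * (‖1 - ∏ k, (1 - damping (a k) (M γ : ℝ)⁻¹ (γ * M γ) ω)‖ / weight ω q c) := by
    intro γ ω
    rw [← mul_div_assoc, ← norm_mul, mul_sub, mul_one, ← hp]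
  have herr_nonneg : ∀ γ ω, 0 ≤ err γ ω := fun γ ω =>
    div_nonneg (norm_nonneg _) (weight_pos ω q c).le
  -- K and the weighted product each contribute a factor 1/(1 + |ω|); the square is a majorant in
  -- both L₁ and L₂, independent of γ.
  have hbound : ∀ γ (ω : ℝ), ω ≠ 0 → err γ ω ≤ C * D * ((1 + |ω|)⁻¹) ^ 2 := by
    intro γ ω hω
    rw [herr_eq]
    have h0 : 0 ≤ ‖1 - ∏ k, (1 - damping (a k) (M γ : ℝ)⁻¹ (γ * M γ) ω)‖ / weight ω q c :=
      div_nonneg (norm_nonneg _) (weight_pos ω q c).le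
    have h1 : ‖1 - ∏ k, (1 - damping (a k) (M γ : ℝ)⁻¹ (γ * M γ) ω)‖ / weight ω q c ≤
        D * (1 + |ω|)⁻¹ := by
      refine hD _ ω (if 1 ≤ |ω| then 1 else Real.exp (c / (2 * (m + 1)) / |ω| ^ q)) hω
        (by split_ifs <;> positivity) ?_ (fun h => by rw [if_pos h]) fun k => ?_
      · split_ifs
        · exact Real.one_le_exp (by positivity)
        · exact le_rfl
      · refine (norm_damping_le (ha k) (haB k) (hM0 γ) (hM1 γ) hω _).trans ?_
        obtain ⟨h2, h3⟩ := hMb γ (a k) (ha k) (haB k) ω hω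
        gcongr
        split_ifs with h
        · exact h3 h
        · exact h2
    calc _ ≤ C * (1 + |ω|)⁻¹ * (D * (1 + |ω|)⁻¹) := by
          gcongr
          exact hC ω
      _ = _ := by ring
  have hlim : ∀ ω : ℝ, ω ≠ 0 → Tendsto (fun γ => err γ ω) atTop (𝓝 0) := by
    intro ω hω
    simp only [herr_eq]
    have h1 : Tendsto (fun γ => ∏ k, (1 - damping (a k) (M γ : ℝ)⁻¹ (γ * M γ) ω)) atTop
        (𝓝 (∏ _k : Fin m, (1 - 0))) :=
      tendsto_finsetProd _ fun k _ =>
        tendsto_const_nhds.sub (tendsto_damping_zero (ha k) (haB k) hω hM)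
    have h2 := (((tendsto_const_nhds (x := (1 : ℂ))).sub h1).norm.div_const
      (weight ω q c)).const_mul ‖K ω‖
    simpa using h2
  -- At ω = 0 division by zero makes the weight 1, so it gives no control there; this point is a
  -- null set.
  have hne : ∀ᵐ ξ : ℝ, 2 * Real.pi * ξ ≠ 0 := by
    filter_upwards [Measure.ae_ne volume (0 : ℝ)] with ξ hξ
    have := Real.pi_pos.ne'
    positivity
  have hmeas : ∀ γ, AEStronglyMeasurable (fun ξ => err γ (2 * Real.pi * ξ)) volume := by
    intro γ
    have h1 := (hKT.sub (hasTransfer_causalKernel (hM0 γ) (p γ)).1).1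
    have h2 : Measurable (err γ) := h1.norm.measurable.div (measurable_weight q c)
    exact (h2.comp (by fun_prop)).aestronglyMeasurable
  set g : ℝ → ℝ := fun ξ => C * D * ((1 + |ξ|)⁻¹) ^ 2 with hg
  have hg1 : Integrable g := integrable_inv_one_add_abs_sq.const_mul _
  have hg2 : MemLp g 2 := by
    refine memLp_two_inv_one_add_abs.of_le_mul (c := |C * D|) (by fun_prop) (.of_forall fun ξ => ?_)
    have h3 : (1 + |ξ|)⁻¹ ≤ 1 := inv_le_one_of_one_le₀ (by simp)
    rw [hg, norm_mul, Real.norm_eq_abs, norm_pow]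
    gcongr
    rw [Real.norm_of_nonneg (by positivity)]
    exact pow_le_of_le_one (by positivity) h3 two_ne_zero
  have hdom : ∀ γ, ∀ᵐ ξ : ℝ, ‖err γ (2 * Real.pi * ξ)‖ ≤ g ξ := by
    intro γ
    filter_upwards [hne] with ξ hξ
    rw [Real.norm_of_nonneg (herr_nonneg _ _)]
    refine (hbound γ _ hξ).trans ?_
    have := abs_le_abs_two_pi_mul ξ
    simp only [hg]
    gcongr
  have htend : ∀ r : ℝ≥0∞, r = 1 ∨ r = 2 →
      Tendsto (fun γ => eLpNorm (fun ξ => err γ (2 * Real.pi * ξ)) r volume) atTop (𝓝 0) := by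
    rintro r hr
    have hgr : MemLp g r := by
      rcases hr with rfl | rfl
      · exact memLp_one_iff_integrable.2 hg1
      · exact hg2
    refine tendsto_eLpNorm_zero_of_dominated (by rcases hr with rfl | rfl <;> simp)
      (by rcases hr with rfl | rfl <;> simp) hmeas hgr hdom ?_
    filter_upwards [hne] with ξ hξ
    exact hlim _ hξ
  obtain ⟨γ, h1, h2⟩ := (((htend 1 (.inl rfl)).eventually (ge_mem_nhds (pos_iff_ne_zero.2 hη))).and
    ((htend 2 (.inr rfl)).eventually (ge_mem_nhds (pos_iff_ne_zero.2 hη)))).exists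
  refine ⟨(M γ : ℝ)⁻¹, p γ, hM0 γ, ?_⟩
  rintro r (rfl | rfl)
  · exact h1
  · exact h2

/-! ### Predictability on 𝒳(q, c) and on the union. -/

theorem exists_causalKernel_yNorm_conv_sub_le {p : ℝ≥0∞} (hp : p = 2 ∨ p = ∞) {q c : ℝ} (hq : 1 < q)
    (hc : 0 < c) {κ : ℝ → ℝ} (hκ : κ ∈ AnticausalKernels) {ε : ℝ} (hε : 0 < ε) :
    ∃ κ' ∈ CausalKernels,
      (∀ x : Lp ℂ 2 (volume : Measure ℝ), MemY p (conv κ x) ∧ MemY p (conv κ' x)) ∧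
      ∀ x ∈ XClass q c, yNorm p (conv κ x - conv κ' x) ≤ ENNReal.ofReal ε * xNorm q c x := by
  obtain ⟨m, a, d, ha, hd, hT⟩ := exists_hasTransfer_of_mem_anticausalKernels hκ
  obtain ⟨δ, P, hδ, h⟩ := exists_causalTransfer_approx hq hc ha hd
    (η := ENNReal.ofReal ε) (by simpa using hε)
  have hT' := hasTransfer_causalKernel hδ P
  exact ⟨causalKernel δ P, causalKernel_mem hδ P,
    fun x => ⟨hT.memY_conv hp x, hT'.memY_conv hp x⟩,
    fun x hx => yNorm_conv_sub_le hp hT hT' h hx⟩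

/-- The classes `𝒳(q, c)` increase as `q` and `c` decrease. -/
theorem xNorm_le_mul_xNorm {q q' c c' : ℝ} (hq' : 0 ≤ q') (hq : q' ≤ q) (hc' : 0 ≤ c')
    (hc : c' ≤ c) (x : Lp ℂ 2 (volume : Measure ℝ)) :
    xNorm q' c' x ≤ ENNReal.ofReal (Real.exp c) * xNorm q c x := by
  have hw : ∀ ω : ℝ, ω ≠ 0 → weight ω q' c' ≤ Real.exp c * weight ω q c := by
    intro ω hω
    have hω0 : 0 < |ω| := abs_pos.2 hω
    rw [weight, weight, ← Real.exp_add]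
    refine Real.exp_le_exp.2 ?_
    have hc0 : 0 ≤ c := hc'.trans hc
    have hnn : 0 ≤ c / |ω| ^ q := by positivity
    -- For |ω| ≥ 1 the order of the powers reverses, but the new exponent is at most c, which
    -- accounts for the constant e^c.
    rcases le_or_gt 1 |ω| with h | h
    · have : c' / |ω| ^ q' ≤ c' := div_le_self hc' (Real.one_le_rpow h hq')
      linarith
    · have : c' / |ω| ^ q' ≤ c / |ω| ^ q :=
        div_le_div₀ hc0 hc (by positivity) (Real.rpow_le_rpow_of_exponent_ge hω0 h.le hq)
      linarith
  refine essSup_le_of_ae_le _ ?_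
  filter_upwards [ENNReal.ae_le_essSup fun ω : ℝ =>
    ‖fourierL2 x ω‖ₑ * ENNReal.ofReal (weight ω q c), Measure.ae_ne volume (0 : ℝ)] with ω h1 h2
  calc ‖fourierL2 x ω‖ₑ * ENNReal.ofReal (weight ω q' c')
      ≤ ‖fourierL2 x ω‖ₑ * ENNReal.ofReal (Real.exp c * weight ω q c) := by
        gcongr
        exact hw ω h2
    _ = ENNReal.ofReal (Real.exp c) * (‖fourierL2 x ω‖ₑ * ENNReal.ofReal (weight ω q c)) := by
        rw [ENNReal.ofReal_mul (Real.exp_pos _).le]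
        ring
    _ ≤ _ := by
        gcongr
        exact h1

theorem weaklyPredictable_xUnion {p : ℝ≥0∞} (hp : p = 2 ∨ p = ∞) :
    WeaklyPredictable p XUnion := by
  intro κ hκ
  have hpos : ∀ j : ℕ, (0 : ℝ) < 1 / ((j : ℝ) + 1) := fun j => Nat.one_div_pos_of_nat
  -- The j-th kernel serves q = 1 + 1/(j+1) and c = ε = 1/(j+1). Each x in the union lies in these
  -- classes for large j, with norms bounded by the fixed number N below.
  choose κ' hκ' hY hN using fun j : ℕ => exists_causalKernel_yNorm_conv_sub_le hp
    (q := 1 + 1 / ((j : ℝ) + 1)) (by linarith [hpos j]) (hpos j) hκ (hpos j)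
  refine ⟨κ', hκ', fun x ⟨q, c, hq, hc, hx⟩ => ⟨(hY 0 x).1, fun j => (hY j x).2, ?_⟩⟩
  have hlim := tendsto_one_div_add_atTop_nhds_zero_nat (𝕜 := ℝ)
  set N : ℝ≥0∞ := ENNReal.ofReal (Real.exp c) * xNorm q c x with hNdef
  have hNfin : N ≠ ∞ := ENNReal.mul_ne_top ENNReal.ofReal_ne_top (ne_of_lt hx)
  have hle : ∀ᶠ j : ℕ in atTop, yNorm p (conv κ x - conv (κ' j) x) ≤
      ENNReal.ofReal (1 / ((j : ℝ) + 1)) * N := by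
    filter_upwards [hlim.eventually (ge_mem_nhds (sub_pos.2 hq)),
      hlim.eventually (ge_mem_nhds hc)] with j h1 h2
    have hx' := xNorm_le_mul_xNorm (q := q) (q' := 1 + 1 / ((j : ℝ) + 1)) (by linarith [hpos j])
      (by linarith) (hpos j).le h2 x
    exact (hN j x (hx'.trans_lt hNfin.lt_top)).trans (by gcongr)
  refine tendsto_of_tendsto_of_tendsto_of_le_of_le' tendsto_const_nhds ?_
    (.of_forall fun _ => zero_le) hle
  have h0 := ENNReal.Tendsto.mul_const (ENNReal.tendsto_ofReal hlim) (.inr hNfin)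
  simpa using h0

end WeakPrediction

theorem theorem1 (p : ENNReal) (hp : p = 2 ∨ p = ⊤) :
    WeakPrediction.WeaklyPredictable p WeakPrediction.XUnion ∧
    ∀ q₀ c₀ : ℝ, 1 < q₀ → 0 < c₀ →
      WeakPrediction.UniformlyWeaklyPredictable p
        (WeakPrediction.XClass q₀ c₀) (WeakPrediction.xNorm q₀ c₀) := by
  refine ⟨WeakPrediction.weaklyPredictable_xUnion hp, fun q c hq hc κ hκ ε hε => ?_⟩
  obtain ⟨κ', hκ', hY, hN⟩ :=
    WeakPrediction.exists_causalKernel_yNorm_conv_sub_le hp hq hc hκ hε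
  exact ⟨κ', hκ', fun x hx => ⟨(hY x).1, (hY x).2, hN x hx⟩⟩
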